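/- Let $d\in\{2,3\}$, let $\Omega\subset\mathbb R^d$ be bounded and open, let $\mu_r,\tau_y:\Omega\to(0,\infty)$ be measurable (reference viscosity and yield stress) with $\tau_y\in L^2(\Omega)$, let $f\in L^2(\Omega)^d$, and let $\underline\mu\ge 0$ be a constant. Let $V$ be the set of all $u\in H^1_0(\Omega)^d$ with $\nabla\cdot u=0$, where $H^1_0(\Omega)^d$ is the closure of $C_c^\infty(\Omega)^d$ in the $H^1$ norm. Put $\dot\varepsilon(u)=\frac12(\nabla u+\nabla u^{T})$ and $\dot\varepsilon_{II}(u)=\big(\frac12\dot\varepsilon(u):\dot\varepsilon(u)\big)^{1/2}$. The ideal and the composite viscosity are $$\mu_i(u)=\underline\mu+\min\Big(\frac{\tau_y}{2\dot\varepsilon_{II}(u)},\mu_r\Big),\qquad \mu_c(u)=\frac{\tau_y\mu_r}{2\dot\varepsilon_{II}(u)\mu_r+\tau_y},$$ where the minimum is $\mu_r$ if $\dot\varepsilon_{II}(u)=0$. For $\sigma\ge0$ let $$\varphi_i(\sigma)=\begin{cases}2\mu_r\sigma^2+\dfrac{\tau_y^2}{2\mu_r}&\text{if }2\mu_r\sigma\le\tau_y,\\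 2\tau_y\sigma&\text{otherwise,}\end{cases}\qquad \varphi_c(\sigma)=2\tau_y\sigma-\frac{\tau_y^2}{\mu_r}\log(\tau_y+2\mu_r\sigma),$$ and, for $u\in V$, $$\Phi(u)=\int_\Omega\varphi(\dot\varepsilon_{II}(u))\,dx+2\underline\mu\int_\Omega\dot\varepsilon_{II}(u)^2\,dx-\int_\Omega f\cdot u\,dx,$$ with $\varphi=\varphi_i$, $\underline\mu\ge0$ for the ideal law, and $\varphi=\varphi_c$, $\underline\mu=0$ for the composite law. For $\mu=\mu_i$ or $\mu=\mu_c$, a velocity solution of the viscoplastic Stokes problem with homogeneous Dirichlet boundary conditions is a $u\in V$ with $\int_\Omega 2\mu(u)\,\dot\varepsilon(u):\dot\varepsilon(v)\,dx=\int_\Omega f\cdot v\,dx$ for all $v\in V$. A velocity-pressure solution is a pair $(u,p)\in V\times L^2(\Omega)$ with $\int_\Omega 2\mu(u)\,\dot\varepsilon(u):\dot\varepsilon(v)\,dx-\int_\Omega p\,\nabla\cdot v\,dx=\int_\Omega f\cdot v\,dx$ for all $v\in H_0^1(\Omega)^d$; then $u$ is a velocity solution. 1. (Ideal law.) If $\varphi_i(0)\in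 L^1(\Omega)$, then for every $\underline\mu\ge0$ all integrals in $\Phi(u)$, $u\in V$, converge and $\Phi$ is convex on $V$; if $\underline\mu>0$, then $\Phi$ is strictly convex on $V$. If $\underline\mu>0$, then (whether or not $\varphi_i(0)\in L^1(\Omega)$) there is exactly one velocity solution, and any two velocity-pressure solutions have the same velocity. 2. (Composite law.) If $\varphi_c(0)\in L^1(\Omega)$, then all integrals in $\Phi(u)$, $u\in V$, converge and $\Phi$ is convex, and even strictly convex, on $V$. In any case there is at most one velocity solution, and any two velocity-pressure solutions have the same velocity. 3. (Ideal law with $\underline\mu=0$.) Uniqueness may fail: for each $d\in\{2,3\}$ there are a bounded, open, connected, nonempty $\Omega\subset\mathbb R^d$, constants $\mu_r,\tau_y>0$ and $f\in L^2(\Omega)^d$ for which there are two velocity-pressure solutions with different velocities; in particular there are two different velocity solutions. (The conditions $\tau_y\in L^2(\Omega)$, $\varphi_i(0)\in L^1(\Omega)$ and $\varphi_c(0)\in L^1(\Omega)$ all hold if $\mu_r$ and $\tau_y$ are bounded above and bounded away from $0$.) -/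

import Mathlib

open MeasureTheory Filter Topology
open scoped ContDiff

noncomputable section

namespace Viscoplastic

/-- Points of `ℝᵈ`, and values of velocity fields. -/
abbrev Vec (d : ℕ) : Type := EuclideanSpace ℝ (Fin d)

/-- Second-order tensors. -/
abbrev Tensor (d : ℕ) : Type := Matrix (Fin d) (Fin d) ℝ

/-- `L²(Ω)ᵈ`; its elements are velocity fields up to equality almost everywhere in `Ω`. -/
abbrev L2 {d : ℕ} (Ω : Set (Vec d)) : Type := Lp (Vec d) 2 (volume.restrict Ω)

/-! ### The Sobolev space of velocities -/

/-- Infinitely differentiable functions with compact support contained in `Ω`. -/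
def IsTest {d : ℕ} {F : Type*} [NormedAddCommGroup F] [NormedSpace ℝ F]
    (Ω : Set (Vec d)) (ψ : Vec d → F) : Prop :=
  ContDiff ℝ ∞ ψ ∧ HasCompactSupport ψ ∧ tsupport ψ ⊆ Ω

/-- Classical partial derivative in the `j`-th coordinate direction. -/
def partialDeriv {d : ℕ} {F : Type*} [NormedAddCommGroup F] [NormedSpace ℝ F]
    (j : Fin d) (ψ : Vec d → F) (x : Vec d) : F :=
  fderiv ℝ ψ x (EuclideanSpace.single j (1 : ℝ))

/-- `G` is a square-integrable weak gradient of `u` in `Ω`: the entry `G i j` is the weak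
derivative `∂ⱼ uᵢ`. -/
def IsWeakGradient {d : ℕ} (Ω : Set (Vec d)) (u : Vec d → Vec d) (G : Vec d → Tensor d) : Prop :=
  (∀ i j : Fin d, MemLp (fun x => G x i j) 2 (volume.restrict Ω)) ∧
  ∀ ψ : Vec d → ℝ, IsTest Ω ψ → ∀ i j : Fin d,
    ∫ x in Ω, u x i * partialDeriv j ψ x = - ∫ x in Ω, G x i j * ψ x

open Classical in
/-- The weak gradient `∇u`. For open `Ω` it is determined almost everywhere in `Ω` as soon as it
exists; the value `0` is used where it does not exist. -/
def weakGradient {d : ℕ} (Ω : Set (Vec d)) (u : Vec d → Vec d) : Vec d → Tensor d :=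
  if h : ∃ G, IsWeakGradient Ω u G then h.choose else 0

/-- `H₀¹(Ω)ᵈ`: the fields in `L²(Ω)ᵈ` with square-integrable weak gradient that are limits, in the
`H¹` norm, of smooth fields with compact support in `Ω`. -/
def H10 {d : ℕ} (Ω : Set (Vec d)) : Set (L2 Ω) :=
  {u | ∃ G : Vec d → Tensor d, IsWeakGradient Ω u G ∧
    ∃ w : ℕ → Vec d → Vec d, (∀ n, IsTest Ω (w n)) ∧
      Tendsto (fun n => eLpNorm (fun x => u x - w n x) 2 (volume.restrict Ω)) atTop (𝓝 0) ∧
      ∀ i j : Fin d, Tendsto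
        (fun n => eLpNorm (fun x => G x i j - partialDeriv j (w n) x i) 2 (volume.restrict Ω))
        atTop (𝓝 0)}

/-- Weak divergence: the trace of the weak gradient. -/
def divergence {d : ℕ} (Ω : Set (Vec d)) (u : Vec d → Vec d) (x : Vec d) : ℝ :=
  (weakGradient Ω u x).trace

/-- The divergence-free fields in `H₀¹(Ω)ᵈ`. -/
def Admissible {d : ℕ} (Ω : Set (Vec d)) : Set (L2 Ω) :=
  {u | u ∈ H10 Ω ∧ ∀ᵐ x ∂(volume.restrict Ω), divergence Ω u x = 0}

/-! ### Strain rate and rheologies -/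

/-- The inner product `A : B` of second-order tensors. -/
def contract {d : ℕ} (A B : Tensor d) : ℝ := ∑ i, ∑ j, A i j * B i j

/-- The strain rate tensor `ε(u) = (∇u + ∇uᵀ) / 2`. -/
def strainRate {d : ℕ} (Ω : Set (Vec d)) (u : Vec d → Vec d) (x : Vec d) : Tensor d :=
  (1 / 2 : ℝ) • (weakGradient Ω u x + (weakGradient Ω u x).transpose)

/-- The second invariant `(ε(u) : ε(u) / 2) ^ (1 / 2)` of the strain rate tensor. -/
def secondInv {d : ℕ} (Ω : Set (Vec d)) (u : Vec d → Vec d) (x : Vec d) : ℝ :=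
  Real.sqrt (1 / 2 * contract (strainRate Ω u x) (strainRate Ω u x))

/-- Effective viscosity of the ideal law, with lower bound `μlow`, reference viscosity `μr` and
yield stress `τy`, at second invariant `s`. At `s = 0` the quotient `τy / (2 s)` is `+∞`, so that
the minimum is `μr`. -/
def viscIdeal (μlow μr τy s : ℝ) : ℝ :=
  μlow + if s = 0 then μr else min (τy / (2 * s)) μr

/-- Effective viscosity of the composite law. -/
def viscComposite (μr τy s : ℝ) : ℝ := τy * μr / (2 * s * μr + τy)

/-- Energy density of the ideal law (without its lower viscosity bound). -/
def phiIdeal (μr τy s : ℝ) : ℝ :=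
  if 2 * μr * s ≤ τy then 2 * μr * s ^ 2 + τy ^ 2 / (2 * μr) else 2 * τy * s

/-- Energy density of the composite law. -/
def phiComposite (μr τy s : ℝ) : ℝ :=
  2 * τy * s - τy ^ 2 / μr * Real.log (τy + 2 * μr * s)

/-! ### Energy and weak solutions -/

/-- The energy
`Φ(u) = ∫ φ(x, II(u)) dx + 2 μlow ∫ II(u)² dx - ∫ f · u dx` over `Ω`, where `φ` may depend on the
point `x` through the reference viscosity and the yield stress. -/
def energy {d : ℕ} (Ω : Set (Vec d)) (φ : Vec d → ℝ → ℝ) (μlow : ℝ) (f : Vec d → Vec d)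
    (u : L2 Ω) : ℝ :=
  (∫ x in Ω, φ x (secondInv Ω u x)) + 2 * μlow * (∫ x in Ω, secondInv Ω u x ^ 2)
    - ∫ x in Ω, inner ℝ (f x) (u x)

/-- The three integrals in `energy` converge. -/
def EnergyFinite {d : ℕ} (Ω : Set (Vec d)) (φ : Vec d → ℝ → ℝ) (f : Vec d → Vec d)
    (u : L2 Ω) : Prop :=
  IntegrableOn (fun x => φ x (secondInv Ω u x)) Ω ∧
  IntegrableOn (fun x => secondInv Ω u x ^ 2) Ω ∧
  IntegrableOn (fun x => inner ℝ (f x) (u x)) Ω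

/-- The integrand `2 μ(u) ε(u) : ε(v) = μ(u) (∇u + ∇uᵀ) : ∇v` of the viscous term, for a viscosity
law `μ x s` at the point `x` and second invariant `s`. -/
def viscousIntegrand {d : ℕ} (Ω : Set (Vec d)) (μ : Vec d → ℝ → ℝ) (u v : Vec d → Vec d)
    (x : Vec d) : ℝ :=
  2 * μ x (secondInv Ω u x) * contract (strainRate Ω u x) (strainRate Ω v x)

/-- `u` is a (weak) velocity solution of the Stokes problem with viscosity law `μ`, force `f` and
homogeneous Dirichlet conditions: `u` is divergence-free and the momentum equation holds when
tested with divergence-free fields (so that the pressure drops out). -/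
def IsVelocitySolution {d : ℕ} (Ω : Set (Vec d)) (μ : Vec d → ℝ → ℝ) (f : Vec d → Vec d)
    (u : L2 Ω) : Prop :=
  u ∈ Admissible Ω ∧ ∀ v ∈ Admissible Ω,
    IntegrableOn (viscousIntegrand Ω μ u v) Ω ∧
    ∫ x in Ω, viscousIntegrand Ω μ u v x = ∫ x in Ω, inner ℝ (f x) (v x)

/-- `(u, p)` is a weak velocity-pressure solution of the Stokes problem: `u` is divergence-free,
`p` is square-integrable, and the momentum equation holds when tested with all of `H₀¹(Ω)ᵈ`. -/
def IsStokesSolution {d : ℕ} (Ω : Set (Vec d)) (μ : Vec d → ℝ → ℝ) (f : Vec d → Vec d)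
    (u : L2 Ω) (p : Vec d → ℝ) : Prop :=
  u ∈ Admissible Ω ∧ MemLp p 2 (volume.restrict Ω) ∧ ∀ v ∈ H10 Ω,
    IntegrableOn (viscousIntegrand Ω μ u v) Ω ∧
    (∫ x in Ω, viscousIntegrand Ω μ u v x) - (∫ x in Ω, p x * divergence Ω v x)
      = ∫ x in Ω, inner ℝ (f x) (v x)

end Viscoplastic

end

/-! For both laws the viscous stress is the gradient of the energy density: as a function of the
second invariant `s`, the derivative of `φ` is `4 μ(s) s`, with `2 μlow s ^ 2` added to `φ` when
there is a lower bound. Everything positive in the theorem follows from the pointwise tangent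
inequality `D A + 2 μ(A) A : (B - A) ≤ D B` for the density `D` on tensors. It is proved for scalars
(`phiIdeal_subgradient`, `phiComposite_subgradient`) and lifted to tensors by Cauchy–Schwarz. It is
strict for the composite law because the logarithm is strictly concave; for the ideal law `μlow`
adds the remainder `μlow |B - A| ^ 2` (`ideal_subgradient`).

Integrating the tangent inequality gives convexity of the energy. Strictness survives integration
because fields in `H₀¹` with the same strain rate are equal, which is Korn's and Poincaré's
inequalities (`eq_of_strainRate_ae_eq`). Uniqueness comes from strict monotonicity of the stress:
the equations for two solutions are both tested with their difference. This never integrates `φ`, so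
no condition on `φ(0)` enters.

For existence, `H₀¹` is modelled as the closure of the graph of the gradient on test functions, and
the divergence-free part is a closed subspace. The energy shifted by `∫ φ(0)` is always finite, as
`0 ≤ φ(s) - φ(0) ≤ 2 τ s`, and it is uniformly convex when `μlow > 0`. Minimizing sequences are
therefore Cauchy, and the minimizer is a critical point (`exists_subgradient_eq_zero`).

Nonuniqueness for `μlow = 0` uses that beyond yield `μ(s) s = τ / 2` no longer depends on `s`. The
flow rotates about an axis with angular velocity `H(torus)`, where `torus` is chosen so that the
second invariant is again a function of `torus` alone (`tensorInv_vortexStrain`). Increasing the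
shear where the material already yields changes the velocity on the core circle but not the stress.
With the force chosen as minus the divergence of that common stress, both flows are solutions with
zero pressure (`isStokesSolution_of_stress`). -/

noncomputable section

namespace Viscoplastic

/-! ### Algebra of second-order tensors -/

section TensorAlgebra

variable {d : ℕ}

/-- The symmetric part of a tensor. -/
def symPart (A : Tensor d) : Tensor d := (1 / 2 : ℝ) • (A + A.transpose)

/-- The second invariant of a tensor. -/
def tensorInv (A : Tensor d) : ℝ := Real.sqrt (1 / 2 * contract A A)

lemma strainRate_eq_symPart (Ω : Set (Vec d)) (u : Vec d → Vec d) (x : Vec d) :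
    strainRate Ω u x = symPart (weakGradient Ω u x) := rfl

lemma secondInv_eq_tensorInv (Ω : Set (Vec d)) (u : Vec d → Vec d) (x : Vec d) :
    secondInv Ω u x = tensorInv (strainRate Ω u x) := rfl

lemma symPart_apply (A : Tensor d) (i j : Fin d) : symPart A i j = 1 / 2 * (A i j + A j i) := by
  simp [symPart]

lemma symPart_add (A B : Tensor d) : symPart (A + B) = symPart A + symPart B := by
  ext i j; simp only [symPart_apply, Matrix.add_apply]; ring

lemma symPart_sub (A B : Tensor d) : symPart (A - B) = symPart A - symPart B := by
  ext i j; simp only [symPart_apply, Matrix.sub_apply]; ring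

lemma symPart_smul (c : ℝ) (A : Tensor d) : symPart (c • A) = c • symPart A := by
  ext i j; simp only [symPart_apply, Matrix.smul_apply, smul_eq_mul]; ring

lemma contract_comm (A B : Tensor d) : contract A B = contract B A := by
  simp only [contract, mul_comm]

lemma contract_add_right (A B C : Tensor d) :
    contract A (B + C) = contract A B + contract A C := by
  simp only [contract, Matrix.add_apply, mul_add, Finset.sum_add_distrib]

lemma contract_sub_right (A B C : Tensor d) :
    contract A (B - C) = contract A B - contract A C := by
  simp only [contract, Matrix.sub_apply, mul_sub, Finset.sum_sub_distrib]

lemma contract_smul_right (c : ℝ) (A B : Tensor d) : contract A (c • B) = c * contract A B := by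
  simp only [contract, Matrix.smul_apply, smul_eq_mul, Finset.mul_sum, mul_left_comm]

lemma contract_add_left (A B C : Tensor d) :
    contract (A + B) C = contract A C + contract B C := by
  rw [contract_comm, contract_add_right, contract_comm C A, contract_comm C B]

lemma contract_sub_left (A B C : Tensor d) :
    contract (A - B) C = contract A C - contract B C := by
  rw [contract_comm, contract_sub_right, contract_comm C A, contract_comm C B]

lemma contract_smul_left (c : ℝ) (A B : Tensor d) : contract (c • A) B = c * contract A B := by
  rw [contract_comm, contract_smul_right, contract_comm]

lemma contract_self_nonneg (A : Tensor d) : 0 ≤ contract A A :=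
  Finset.sum_nonneg fun _ _ => Finset.sum_nonneg fun _ _ => mul_self_nonneg _

lemma sq_entry_le_contract (A : Tensor d) (i j : Fin d) : A i j ^ 2 ≤ contract A A := by
  rw [sq]
  calc A i j * A i j ≤ ∑ j, A i j * A i j :=
        Finset.single_le_sum (f := fun j => A i j * A i j) (fun _ _ => mul_self_nonneg _)
          (Finset.mem_univ j)
    _ ≤ contract A A :=
        Finset.single_le_sum (f := fun i => ∑ j, A i j * A i j)
          (fun _ _ => Finset.sum_nonneg fun _ _ => mul_self_nonneg _) (Finset.mem_univ i)

lemma eq_zero_of_contract_self (A : Tensor d) (h : contract A A = 0) : A = 0 := by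
  ext i j
  exact pow_eq_zero_iff two_ne_zero |>.1
    (le_antisymm (h ▸ sq_entry_le_contract A i j) (sq_nonneg _))

lemma contract_self_pos {A : Tensor d} (h : A ≠ 0) : 0 < contract A A :=
  lt_of_le_of_ne (contract_self_nonneg A) fun h0 => h (eq_zero_of_contract_self A h0.symm)

lemma tensorInv_nonneg (A : Tensor d) : 0 ≤ tensorInv A := Real.sqrt_nonneg _

lemma tensorInv_sq (A : Tensor d) : tensorInv A ^ 2 = 1 / 2 * contract A A :=
  Real.sq_sqrt (by have := contract_self_nonneg A; positivity)

lemma contract_self_eq (A : Tensor d) : contract A A = 2 * tensorInv A ^ 2 := by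
  rw [tensorInv_sq]; ring

lemma abs_entry_le (A : Tensor d) (i j : Fin d) : |A i j| ≤ 2 * tensorInv A := by
  apply abs_le_of_sq_le_sq _ (by have := tensorInv_nonneg A; positivity)
  have := sq_entry_le_contract A i j
  have h2 := tensorInv_sq A
  nlinarith [contract_self_nonneg A]

/-- Cauchy–Schwarz over pairs of indices. The factor 2 undoes the factor 1/2 under the root of each
invariant. -/
lemma abs_contract_le (A B : Tensor d) : |contract A B| ≤ 2 * tensorInv A * tensorInv B := by
  have hA := tensorInv_nonneg A
  have hB := tensorInv_nonneg B
  apply abs_le_of_sq_le_sq _ (by positivity)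
  have h := Finset.sum_mul_sq_le_sq_mul_sq (Finset.univ : Finset (Fin d × Fin d))
    (fun p => A p.1 p.2) (fun p => B p.1 p.2)
  simp only [Fintype.sum_prod_type, pow_two (A _ _), pow_two (B _ _)] at h
  change contract A B ^ 2 ≤ contract A A * contract B B at h
  rw [contract_self_eq, contract_self_eq] at h
  linarith [h]

lemma contract_self_sub (A B : Tensor d) :
    contract (B - A) (B - A) = contract B B - 2 * contract A B + contract A A := by
  rw [contract_sub_left, contract_sub_right, contract_sub_right, contract_comm B A]; ring

/-- A scalar subgradient inequality in the second invariant gives one for tensors. -/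
lemma tensor_subgradient {φ μ : ℝ → ℝ} (hμ : ∀ s, 0 ≤ s → 0 ≤ μ s)
    (h : ∀ s t, 0 ≤ s → 0 ≤ t → φ s + 4 * μ s * s * (t - s) ≤ φ t) (A B : Tensor d) :
    φ (tensorInv A) + 2 * μ (tensorInv A) * contract A (B - A) ≤ φ (tensorInv B) := by
  have hA := tensorInv_nonneg A
  have h1 := h _ _ hA (tensorInv_nonneg B)
  have h2 := le_of_abs_le (abs_contract_le A B)
  have h3 := mul_le_mul_of_nonneg_left h2 (hμ _ hA)
  rw [contract_sub_right, contract_self_eq]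
  linarith

/-- Strictness has two sources. If the invariants differ, the scalar inequality is strict. If they
agree, `|B - A| ^ 2 > 0` makes Cauchy–Schwarz strict, and positivity of `μ` preserves this. -/
lemma tensor_subgradient_strict {φ μ : ℝ → ℝ} (hμ : ∀ s, 0 ≤ s → 0 < μ s)
    (h : ∀ s t, 0 ≤ s → 0 ≤ t → s ≠ t → φ s + 4 * μ s * s * (t - s) < φ t) {A B : Tensor d}
    (hAB : A ≠ B) :
    φ (tensorInv A) + 2 * μ (tensorInv A) * contract A (B - A) < φ (tensorInv B) := by
  have hA := tensorInv_nonneg A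
  rw [contract_sub_right, contract_self_eq]
  by_cases hs : tensorInv A = tensorInv B
  · have h4 := contract_self_pos (sub_ne_zero.2 hAB.symm)
    rw [contract_self_sub, contract_self_eq, contract_self_eq] at h4
    have h5 : contract A B < 2 * tensorInv A ^ 2 := by rw [← hs] at h4; linarith
    have h6 := mul_lt_mul_of_pos_left h5 (hμ _ hA)
    rw [← hs]
    linarith
  · have h1 := h _ _ hA (tensorInv_nonneg B) hs
    have h2 := le_of_abs_le (abs_contract_le A B)
    have h3 := mul_le_mul_of_nonneg_left h2 (hμ _ hA).le
    linarith

lemma tensorInv_smul (c : ℝ) (A : Tensor d) : tensorInv (c • A) = |c| * tensorInv A := by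
  rw [tensorInv, contract_smul_left, contract_smul_right, ← Real.sqrt_sq_eq_abs, tensorInv,
    ← Real.sqrt_mul (sq_nonneg c)]
  congr 1; ring

lemma continuous_contract : Continuous fun p : Tensor d × Tensor d => contract p.1 p.2 := by
  unfold contract
  refine continuous_finsetSum _ fun i _ => continuous_finsetSum _ fun j _ => ?_
  exact (continuous_fst.matrix_elem i j).mul (continuous_snd.matrix_elem i j)

lemma continuous_tensorInv : Continuous (tensorInv (d := d)) :=
  Real.continuous_sqrt.comp (continuous_const.mul
    (continuous_contract.comp (continuous_id.prodMk continuous_id)))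

end TensorAlgebra

/-! ### The rheologies -/

section Rheology

variable {μ τ : ℝ}

/-- A single quotient with positive denominator replaces the case distinction. It absorbs the
convention at `s = 0` and makes continuity in `s` evident. -/
lemma viscIdeal_eq (hμ : 0 < μ) (hτ : 0 < τ) (m : ℝ) {s : ℝ} (hs : 0 ≤ s) :
    viscIdeal m μ τ s = m + τ * μ / max τ (2 * μ * s) := by
  unfold viscIdeal
  congr 1
  split_ifs with h
  · subst h
    rw [mul_zero, max_eq_left hτ.le]; field_simp
  · have hs' : 0 < s := lt_of_le_of_ne hs (Ne.symm h)
    rcases le_total τ (2 * μ * s) with h1 | h1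
    · rw [max_eq_right h1, min_eq_left (by rw [div_le_iff₀ (by positivity)]; linarith)]
      field_simp
    · rw [max_eq_left h1, min_eq_right (by rw [le_div_iff₀ (by positivity)]; linarith)]
      field_simp

lemma viscIdeal_zero_nonneg (hμ : 0 < μ) (hτ : 0 < τ) {s : ℝ} (hs : 0 ≤ s) :
    0 ≤ viscIdeal 0 μ τ s := by
  rw [viscIdeal_eq hμ hτ 0 hs]; positivity

/-- The stress saturates at the yield stress. This is why `τy ∈ L²` suffices and `μr` need not be
bounded. -/
lemma viscIdeal_zero_mul_le (hμ : 0 < μ) (hτ : 0 < τ) {s : ℝ} (hs : 0 ≤ s) :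
    viscIdeal 0 μ τ s * s ≤ τ / 2 := by
  have hm : 0 < max τ (2 * μ * s) := lt_max_of_lt_left hτ
  rw [viscIdeal_eq hμ hτ 0 hs, zero_add, div_mul_eq_mul_div, div_le_iff₀ hm]
  have := mul_le_mul_of_nonneg_left (le_max_right τ (2 * μ * s)) hτ.le
  linarith

lemma viscIdeal_split (m μ τ s : ℝ) : viscIdeal m μ τ s = m + viscIdeal 0 μ τ s := by
  simp [viscIdeal]

lemma viscIdeal_zero_of_le (hμ : 0 < μ) (hτ : 0 < τ) {s : ℝ} (hs : 0 ≤ s) (h : 2 * μ * s ≤ τ) :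
    viscIdeal 0 μ τ s = μ := by
  rw [viscIdeal_eq hμ hτ 0 hs, max_eq_left h]; field_simp; simp

lemma viscIdeal_zero_of_ge (hμ : 0 < μ) (hτ : 0 < τ) {s : ℝ} (hs : 0 ≤ s) (h : τ ≤ 2 * μ * s) :
    viscIdeal 0 μ τ s * s = τ / 2 := by
  have : 0 < 2 * μ * s := lt_of_lt_of_le hτ h
  rw [viscIdeal_eq hμ hτ 0 hs, max_eq_right h]
  rw [zero_add, div_mul_eq_mul_div, div_eq_iff this.ne']; ring

/-- `φ` is a parabola continued by its tangent at the yield point, so it lies above all its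
tangents. After multiplication by `μ`, each pair of branches reduces to a square or a product of
nonnegative factors. Equality holds when both points are in the plastic range, where `φ` is affine;
hence there is no strictness. -/
lemma phiIdeal_subgradient (hμ : 0 < μ) (hτ : 0 < τ) {s : ℝ} (hs : 0 ≤ s) (t : ℝ) :
    phiIdeal μ τ s + 4 * viscIdeal 0 μ τ s * s * (t - s) ≤ phiIdeal μ τ t := by
  have hd : 2 * μ * (τ ^ 2 / (2 * μ)) = τ ^ 2 := by field_simp
  set q := τ ^ 2 / (2 * μ) with hq
  have key : ∀ a b : ℝ, μ * a ≤ μ * b → a ≤ b := fun a b h => le_of_mul_le_mul_left h hμ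
  apply key
  unfold phiIdeal
  split_ifs with h1 h2 h2
  · rw [viscIdeal_zero_of_le hμ hτ hs h1]
    nlinarith [sq_nonneg (μ * (t - s))]
  · rw [viscIdeal_zero_of_le hμ hτ hs h1]
    push Not at h2
    nlinarith [mul_nonneg (sub_nonneg.2 h1) (sub_nonneg.2 h2.le), sq_nonneg (τ - 2 * μ * s)]
  · push Not at h1
    have h3 := viscIdeal_zero_of_ge hμ hτ hs h1.le
    have : 4 * viscIdeal 0 μ τ s * s * (t - s) = 2 * τ * (t - s) := by
      rw [show 4 * viscIdeal 0 μ τ s * s = 4 * (viscIdeal 0 μ τ s * s) by ring, h3]; ring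
    rw [this]
    nlinarith [sq_nonneg (2 * μ * t - τ)]
  · push Not at h1
    have h3 := viscIdeal_zero_of_ge hμ hτ hs h1.le
    have : 4 * viscIdeal 0 μ τ s * s * (t - s) = 2 * τ * (t - s) := by
      rw [show 4 * viscIdeal 0 μ τ s * s = 4 * (viscIdeal 0 μ τ s * s) by ring, h3]; ring
    rw [this]
    apply le_of_eq; ring

lemma phiIdeal_sub_nonneg (hμ : 0 < μ) (hτ : 0 < τ) (s : ℝ) :
    0 ≤ phiIdeal μ τ s - phiIdeal μ τ 0 := by
  have := phiIdeal_subgradient hμ hτ le_rfl s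
  linarith

lemma phiIdeal_sub_le (hμ : 0 < μ) (hτ : 0 < τ) {s : ℝ} (hs : 0 ≤ s) :
    phiIdeal μ τ s - phiIdeal μ τ 0 ≤ 2 * τ * s := by
  have := phiIdeal_subgradient hμ hτ hs 0
  have h2 := mul_le_mul_of_nonneg_right (viscIdeal_zero_mul_le hμ hτ hs) hs
  linarith

lemma viscComposite_pos (hμ : 0 < μ) (hτ : 0 < τ) {s : ℝ} (hs : 0 ≤ s) :
    0 < viscComposite μ τ s := by
  unfold viscComposite; positivity

/-- This is `log r < r - 1` for `r = (τ + 2 μ t) / (τ + 2 μ s) ≠ 1`, scaled by `τ ^ 2 / μ`. -/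
lemma phiComposite_subgradient (hμ : 0 < μ) (hτ : 0 < τ) {s t : ℝ} (hs : 0 ≤ s) (ht : 0 ≤ t)
    (hst : s ≠ t) :
    phiComposite μ τ s + 4 * viscComposite μ τ s * s * (t - s) < phiComposite μ τ t := by
  have h1 : 0 < τ + 2 * μ * s := by positivity
  have h2 : 0 < τ + 2 * μ * t := by positivity
  have h3 : (τ + 2 * μ * t) / (τ + 2 * μ * s) ≠ 1 := by
    rw [Ne, div_eq_one_iff_eq h1.ne']
    intro h
    exact hst (mul_left_cancel₀ (mul_pos two_pos hμ).ne' (by linarith))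
  have h4 := Real.log_lt_sub_one_of_pos (div_pos h2 h1) h3
  rw [Real.log_div h2.ne' h1.ne'] at h4
  have h5 := mul_lt_mul_of_pos_left h4 (show 0 < τ ^ 2 / μ by positivity)
  have h6 : 4 * viscComposite μ τ s * s * (t - s)
      = 2 * τ * (t - s) - τ ^ 2 / μ * ((τ + 2 * μ * t) / (τ + 2 * μ * s) - 1) := by
    unfold viscComposite
    rw [show 2 * s * μ + τ = τ + 2 * μ * s by ring]
    field_simp; ring
  rw [h6]
  unfold phiComposite
  linarith

lemma phiComposite_sub_nonneg (hμ : 0 < μ) (hτ : 0 < τ) {s : ℝ} (hs : 0 ≤ s) :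
    0 ≤ phiComposite μ τ s - phiComposite μ τ 0 := by
  rcases hs.eq_or_lt with h | h
  · subst h; simp
  · have := phiComposite_subgradient hμ hτ le_rfl hs h.ne
    linarith

lemma phiComposite_sub_le (hμ : 0 < μ) (hτ : 0 < τ) {s : ℝ} (hs : 0 ≤ s) :
    phiComposite μ τ s - phiComposite μ τ 0 ≤ 2 * τ * s := by
  have h1 : Real.log τ ≤ Real.log (τ + 2 * μ * s) :=
    Real.log_le_log hτ (by have : 0 ≤ 2 * μ * s := by positivity
                           linarith)
  have h2 := mul_le_mul_of_nonneg_left h1 (show 0 ≤ τ ^ 2 / μ by positivity)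
  unfold phiComposite
  simp only [mul_zero, add_zero]
  linarith

end Rheology

/-! ### Minimization of strongly convex functionals -/

/-- A functional with a hemicontinuous, uniformly strong subgradient `A` on a Banach space has a
critical point. -/
lemma exists_subgradient_eq_zero {X : Type*} [NormedAddCommGroup X] [NormedSpace ℝ X]
    [CompleteSpace X] (J : X → ℝ) (A : X → X →L[ℝ] ℝ) {c : ℝ} (hc : 0 < c)
    (hJ : ∀ x y, J x + A x (y - x) + c * ‖y - x‖ ^ 2 ≤ J y)
    (hA : ∀ x v, Tendsto (fun t : ℝ => A (x + t • v) v) (𝓝[>] 0) (𝓝 (A x v))) :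
    ∃ x, ∀ v, A x v = 0 := by
  -- The quadratic term at base point `0` absorbs the linear one by completing the square.
  have hbdd : BddBelow (Set.range J) := by
    refine ⟨J 0 - ‖A 0‖ ^ 2 / (4 * c), ?_⟩
    rintro _ ⟨y, rfl⟩
    have h1 := hJ 0 y
    simp only [sub_zero] at h1
    have h2 : -(‖A 0‖ * ‖y‖) ≤ A 0 y := by
      have := (A 0).le_opNorm y
      rw [Real.norm_eq_abs] at this
      exact (abs_le.1 this).1
    have h3 : ‖A 0‖ * ‖y‖ - c * ‖y‖ ^ 2 ≤ ‖A 0‖ ^ 2 / (4 * c) := by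
      rw [le_div_iff₀ (by positivity)]
      nlinarith [sq_nonneg (‖A 0‖ - 2 * c * ‖y‖)]
    linarith
  set m := iInf J with hm
  have hle : ∀ x, m ≤ J x := fun x => ciInf_le hbdd x
  have hmin : ∀ n : ℕ, ∃ x, J x < m + 1 / ((n : ℝ) + 1) := fun n =>
    exists_lt_of_ciInf_lt (lt_add_of_pos_right _ Nat.one_div_pos_of_nat)
  choose u hu using hmin
  -- The inequalities based at the midpoint `z`, in the directions of `x` and `y`, are added: the
  -- linear terms cancel. This makes minimizing sequences Cauchy.
  have hpar : ∀ x y, c / 2 * ‖x - y‖ ^ 2 ≤ (J x - m) + (J y - m) := by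
    intro x y
    set z := (1 / 2 : ℝ) • (x + y) with hz
    have hx : x - z = (1 / 2 : ℝ) • (x - y) := by rw [hz]; module
    have hy : y - z = -((1 / 2 : ℝ) • (x - y)) := by rw [hz]; module
    have h1 := hJ z x
    have h2 := hJ z y
    rw [hx] at h1
    rw [hy, norm_neg, map_neg] at h2
    rw [norm_smul, mul_pow] at h1 h2
    norm_num at h1 h2
    have := hle z
    linarith
  have hcauchy : CauchySeq u := by
    have hlim : Tendsto (fun n : ℕ => Real.sqrt (4 / c * (1 / ((n : ℝ) + 1)))) atTop (𝓝 0) := by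
      have := (tendsto_one_div_add_atTop_nhds_zero_nat (𝕜 := ℝ)).const_mul (4 / c)
      rw [mul_zero] at this
      have h := (Real.continuous_sqrt.tendsto 0).comp this
      rwa [Real.sqrt_zero] at h
    refine cauchySeq_of_le_tendsto_0 _ (fun n k N hn hk => ?_) hlim
    rw [dist_eq_norm]
    apply Real.le_sqrt_of_sq_le
    have h1 := hpar (u n) (u k)
    have h2 := hu n
    have h3 := hu k
    have h4 : 1 / ((n : ℝ) + 1) ≤ 1 / ((N : ℝ) + 1) := by gcongr
    have h5 : 1 / ((k : ℝ) + 1) ≤ 1 / ((N : ℝ) + 1) := by gcongr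
    have h6 : c / 2 * ‖u n - u k‖ ^ 2 ≤ 2 * (1 / ((N : ℝ) + 1)) := by linarith
    rw [show (4 / c * (1 / ((N : ℝ) + 1))) = (2 * (1 / ((N : ℝ) + 1))) / (c / 2) by
      field_simp; norm_num, le_div_iff₀ (by positivity)]
    linarith
  obtain ⟨x, hx⟩ := cauchySeq_tendsto_of_complete hcauchy
  -- Continuity of `J` is not assumed; the affine minorant of `J` at the limit gives the lower
  -- semicontinuity needed.
  have hJx : J x ≤ m := by
    have h1 : Tendsto (fun n => J x + A x (u n - x)) atTop (𝓝 (J x)) := by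
      have h := ((A x).continuous.tendsto _).comp (hx.sub_const x)
      rw [sub_self, map_zero] at h
      simpa using h.const_add (J x)
    have h2 : Tendsto (fun n : ℕ => m + 1 / ((n : ℝ) + 1)) atTop (𝓝 m) := by
      simpa using (tendsto_one_div_add_atTop_nhds_zero_nat (𝕜 := ℝ)).const_add m
    refine le_of_tendsto_of_tendsto' h1 h2 fun n => ?_
    have h3 := hJ x (u n)
    have h4 : 0 ≤ c * ‖u n - x‖ ^ 2 := by positivity
    linarith [hu n]
  -- `J` need not be differentiable: the inequality based at `x + t • v` and looking back at the
  -- minimizer `x` gives `0 ≤ A (x + t • v) v`, and hemicontinuity lets `t` tend to `0`.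
  have hnonneg : ∀ v, 0 ≤ A x v := by
    intro v
    refine ge_of_tendsto (hA x v) ?_
    filter_upwards [self_mem_nhdsWithin] with t ht
    have ht : 0 < t := ht
    have h1 := hJ (x + t • v) x
    have h2 := hle (x + t • v)
    rw [show x - (x + t • v) = -(t • v) by abel, map_neg, map_smul, smul_eq_mul] at h1
    have h3 : 0 ≤ c * ‖-(t • v)‖ ^ 2 := by positivity
    have h4 : 0 ≤ t * A (x + t • v) v := by linarith
    exact nonneg_of_mul_nonneg_right h4 ht
  refine ⟨x, fun v => le_antisymm ?_ (hnonneg v)⟩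
  have := hnonneg (-v)
  rw [map_neg] at this
  linarith

/-! ### Test functions -/

section TestFunctions

variable {d : ℕ} {Ω : Set (Vec d)} {F : Type*} [NormedAddCommGroup F] [NormedSpace ℝ F]

lemma IsTest.differentiable {ψ : Vec d → F} (h : IsTest Ω ψ) : Differentiable ℝ ψ :=
  h.1.differentiable (by simp)

lemma IsTest.add {ψ χ : Vec d → F} (h : IsTest Ω ψ) (h' : IsTest Ω χ) :
    IsTest Ω (fun x => ψ x + χ x) :=
  ⟨h.1.add h'.1, h.2.1.add h'.2.1, (tsupport_add ψ χ).trans (Set.union_subset h.2.2 h'.2.2)⟩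

lemma IsTest.const_smul {ψ : Vec d → F} (h : IsTest Ω ψ) (c : ℝ) :
    IsTest Ω (fun x => c • ψ x) :=
  ⟨h.1.const_smul c, h.2.1.smul_left (f := fun _ => c),
    (tsupport_smul_subset_right (fun _ => c) ψ).trans h.2.2⟩

lemma isTest_zero : IsTest Ω (fun _ : Vec d => (0 : F)) :=
  ⟨contDiff_const, HasCompactSupport.zero, by
    rw [show (fun _ : Vec d => (0 : F)) = 0 from rfl, tsupport_eq_empty_iff.2 rfl]; simp⟩

lemma IsTest.pderiv {ψ : Vec d → F} (h : IsTest Ω ψ) (j : Fin d) :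
    IsTest Ω (partialDeriv j ψ) := by
  refine ⟨?_, h.2.1.fderiv_apply ℝ _, ?_⟩
  · exact (h.1.fderiv_right (by simp)).clm_apply contDiff_const
  · exact (tsupport_fderiv_apply_subset ℝ _).trans h.2.2

lemma IsTest.coord {w : Vec d → Vec d} (h : IsTest Ω w) (i : Fin d) :
    IsTest Ω (fun x => w x i) :=
  ⟨contDiff_euclidean.1 h.1 i, h.2.1.comp_left (g := fun v : Vec d => v i) rfl,
    (closure_mono (Function.support_comp_subset (g := fun v : Vec d => v i) rfl w)).trans h.2.2⟩

lemma IsTest.eq_zero {ψ : Vec d → F} (h : IsTest Ω ψ) {x : Vec d} (hx : x ∉ Ω) : ψ x = 0 :=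
  image_eq_zero_of_notMem_tsupport fun hx' => hx (h.2.2 hx')

lemma IsTest.memLp {ψ : Vec d → F} (h : IsTest Ω ψ) (S : Set (Vec d)) (p : ENNReal) :
    MemLp ψ p (volume.restrict S) :=
  h.1.continuous.memLp_of_hasCompactSupport h.2.1

lemma partialDeriv_coord {w : Vec d → Vec d} {x : Vec d} (h : DifferentiableAt ℝ w x)
    (i j : Fin d) : partialDeriv j (fun y => w y i) x = partialDeriv j w x i := by
  unfold partialDeriv
  have := (EuclideanSpace.proj i : Vec d →L[ℝ] ℝ).hasFDerivAt.comp x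
    h.hasFDerivAt
  have h2 : HasFDerivAt (fun y => w y i) _ x := this
  rw [h2.fderiv]
  simp

lemma partialDeriv_add {ψ χ : Vec d → F} {x : Vec d} (h : DifferentiableAt ℝ ψ x)
    (h' : DifferentiableAt ℝ χ x) (j : Fin d) :
    partialDeriv j (fun y => ψ y + χ y) x = partialDeriv j ψ x + partialDeriv j χ x := by
  unfold partialDeriv
  rw [fderiv_fun_add h h']; rfl

lemma partialDeriv_const_smul {ψ : Vec d → F} {x : Vec d} (h : DifferentiableAt ℝ ψ x) (c : ℝ)
    (j : Fin d) : partialDeriv j (fun y => c • ψ y) x = c • partialDeriv j ψ x := by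
  unfold partialDeriv
  rw [fderiv_fun_const_smul h]; rfl

lemma partialDeriv_mul {a b : Vec d → ℝ} {x : Vec d} (ha : DifferentiableAt ℝ a x)
    (hb : DifferentiableAt ℝ b x) (j : Fin d) :
    partialDeriv j (fun y => a y * b y) x = a x * partialDeriv j b x + b x * partialDeriv j a x := by
  unfold partialDeriv
  rw [fderiv_fun_mul ha hb]; simp

lemma partialDeriv_comm {ψ : Vec d → F} (h : ContDiff ℝ ∞ ψ) (i j : Fin d) (x : Vec d) :
    partialDeriv i (partialDeriv j ψ) x = partialDeriv j (partialDeriv i ψ) x := by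
  have hs : IsSymmSndFDerivAt ℝ ψ x := (h.contDiffAt (x := x)).isSymmSndFDerivAt (by
    simp only [minSmoothness_of_isRCLikeNormedField]; exact ENat.LEInfty.out)
  have hd : DifferentiableAt ℝ (fderiv ℝ ψ) x :=
    (h.fderiv_right (m := ∞) (by simp)).differentiable (by simp) x
  have key : ∀ k l : Fin d, partialDeriv k (partialDeriv l ψ) x
      = fderiv ℝ (fderiv ℝ ψ) x (EuclideanSpace.single k 1) (EuclideanSpace.single l 1) := by
    intro k l
    unfold partialDeriv
    rw [fderiv_clm_apply hd (differentiableAt_const _)]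
    simp
  rw [key, key]
  exact hs _ _

/-- Integration by parts against a test function. -/
lemma integral_mul_partialDeriv {a ψ : Vec d → ℝ} (ha : ContDiff ℝ ∞ a) (h : IsTest Ω ψ)
    (j : Fin d) :
    ∫ x in Ω, a x * partialDeriv j ψ x = -∫ x in Ω, partialDeriv j a x * ψ x := by
  have hda : Continuous (partialDeriv j a) :=
    ((ha.fderiv_right (m := ∞) (by simp)).clm_apply contDiff_const).continuous
  rw [setIntegral_eq_integral_of_forall_compl_eq_zero fun x hx => by
      rw [(h.pderiv j).eq_zero hx, mul_zero],
    setIntegral_eq_integral_of_forall_compl_eq_zero fun x hx => by rw [h.eq_zero hx, mul_zero]]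
  apply integral_mul_fderiv_eq_neg_fderiv_mul_of_integrable
  · exact (hda.mul h.1.continuous).integrable_of_hasCompactSupport h.2.1.mul_left
  · exact (ha.continuous.mul (h.pderiv j).1.continuous).integrable_of_hasCompactSupport
      (h.pderiv j).2.1.mul_left
  · exact (ha.continuous.mul h.1.continuous).integrable_of_hasCompactSupport h.2.1.mul_left
  · exact fun x _ => (ha.differentiable (by simp)) x
  · exact fun x _ => h.differentiable x

lemma IsTest.integrable_mul {a b : Vec d → ℝ} (ha : IsTest Ω a) (hb : IsTest Ω b) :
    IntegrableOn (fun x => a x * b x) Ω :=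
  (ha.memLp Ω 2).integrable_mul (hb.memLp Ω 2)

/-- Poincaré's inequality for test functions. -/
lemma IsTest.poincare {ψ : Vec d → ℝ} (h : IsTest Ω ψ) (hΩ : MeasurableSet Ω) (j : Fin d) {R : ℝ}
    (hR : ∀ x ∈ Ω, |x j| ≤ R) :
    ∫ x in Ω, ψ x * ψ x ≤ 4 * R ^ 2 * ∫ x in Ω, partialDeriv j ψ x * partialDeriv j ψ x := by
  have hx : ContDiff ℝ ∞ (fun x : Vec d => x j) := contDiff_euclidean.1 contDiff_id j
  have hxd : ∀ x : Vec d, partialDeriv j (fun x : Vec d => x j) x = 1 := by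
    intro x
    rw [partialDeriv_coord (w := fun y => y) differentiableAt_id]
    simp [partialDeriv]
  -- Integrating by parts with the factor `x j * ψ` turns `∂ⱼ xⱼ = 1` into `∫ ψ² = -2 ∫ xⱼ ψ ∂ⱼψ`.
  -- Young's inequality then absorbs half of the left side, which yields the constant `4 R ^ 2`.
  have hI := integral_mul_partialDeriv (hx.mul h.1) h j
  have hT : IsTest Ω (fun x => x j * ψ x) := ⟨hx.mul h.1, h.2.1.mul_left,
    (tsupport_mul_subset_right).trans h.2.2⟩
  have h1 : ∀ x, partialDeriv j (fun x => x j * ψ x) x * ψ x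
      = x j * ψ x * partialDeriv j ψ x + ψ x * ψ x := by
    intro x
    rw [partialDeriv_mul (hx.differentiable (by simp) x) (h.differentiable x), hxd]; ring
  simp only [h1] at hI
  have i1 := hT.integrable_mul (h.pderiv j)
  have i2 := h.integrable_mul h
  have i3 := (h.pderiv j).integrable_mul (h.pderiv j)
  rw [integral_add i1 i2] at hI
  have h2 : -2 * ∫ x in Ω, x j * ψ x * partialDeriv j ψ x
      ≤ 1 / 2 * (∫ x in Ω, ψ x * ψ x)
        + 2 * R ^ 2 * ∫ x in Ω, partialDeriv j ψ x * partialDeriv j ψ x := by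
    rw [← integral_const_mul, ← integral_const_mul, ← integral_const_mul,
      ← integral_add (i2.const_mul _) (i3.const_mul _)]
    refine setIntegral_mono_on (i1.const_mul _) ((i2.const_mul _).add (i3.const_mul _)) hΩ ?_
    intro x hxΩ
    have h3 : x j ^ 2 ≤ R ^ 2 := sq_le_sq' (abs_le.1 (hR x hxΩ)).1 (abs_le.1 (hR x hxΩ)).2
    have h4 := mul_le_mul_of_nonneg_right h3 (sq_nonneg (partialDeriv j ψ x))
    simp only
    nlinarith [sq_nonneg (ψ x + 2 * x j * partialDeriv j ψ x)]
  linarith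

/-- The identity behind Korn's inequality. -/
lemma IsTest.integral_pderiv_swap {a b : Vec d → ℝ} (ha : IsTest Ω a) (hb : IsTest Ω b)
    (i j : Fin d) :
    ∫ x in Ω, partialDeriv j a x * partialDeriv i b x
      = ∫ x in Ω, partialDeriv i a x * partialDeriv j b x := by
  have h1 := integral_mul_partialDeriv ha.1 (hb.pderiv i) j
  have h2 := integral_mul_partialDeriv ha.1 (hb.pderiv j) i
  simp only [partialDeriv_comm hb.1 i j] at h2
  linarith

lemma IsTest.isWeakGradient {w : Vec d → Vec d} (h : IsTest Ω w) :
    IsWeakGradient Ω w (fun x => Matrix.of fun i j => partialDeriv j w x i) := by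
  refine ⟨fun i j => ((h.pderiv j).coord i).memLp Ω 2, fun ψ hψ i j => ?_⟩
  rw [integral_mul_partialDeriv (h.coord i).1 hψ j]
  simp only [partialDeriv_coord (h.differentiable _), Matrix.of_apply]

end TestFunctions

/-! ### The graph of the weak gradient -/

section SobolevGraph

variable {d : ℕ} {Ω : Set (Vec d)}

lemma integrable_mul_of_memLp {α : Type*} [MeasurableSpace α] {ν : Measure α} {a b : α → ℝ}
    (ha : MemLp a 2 ν) (hb : MemLp b 2 ν) : Integrable (fun x => a x * b x) ν :=
  ha.integrable_mul hb

/-- Square-integrable tensor fields, entry by entry. -/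
abbrev TensorL2 {d : ℕ} (Ω : Set (Vec d)) : Type :=
  Fin d → Fin d → Lp ℝ 2 (volume.restrict Ω)

/-- A representative of a square-integrable tensor field. -/
def tensorField (g : TensorL2 Ω) (x : Vec d) : Tensor d := Matrix.of fun i j => g i j x

lemma tensorField_apply (g : TensorL2 Ω) (x : Vec d) (i j : Fin d) :
    tensorField g x i j = g i j x := rfl

lemma tensorField_add (g h : TensorL2 Ω) :
    ∀ᵐ x ∂(volume.restrict Ω), tensorField (g + h) x = tensorField g x + tensorField h x := by
  have : ∀ i j, ∀ᵐ x ∂(volume.restrict Ω), (g i j + h i j) x = g i j x + h i j x :=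
    fun i j => Lp.coeFn_add (g i j) (h i j)
  filter_upwards [ae_all_iff.2 fun i => ae_all_iff.2 (this i)] with x hx
  ext i j
  exact hx i j

lemma tensorField_smul (c : ℝ) (g : TensorL2 Ω) :
    ∀ᵐ x ∂(volume.restrict Ω), tensorField (c • g) x = c • tensorField g x := by
  have : ∀ i j, ∀ᵐ x ∂(volume.restrict Ω), (c • g i j) x = c • g i j x :=
    fun i j => Lp.coeFn_smul c (g i j)
  filter_upwards [ae_all_iff.2 fun i => ae_all_iff.2 (this i)] with x hx
  ext i j
  exact hx i j

lemma tensorField_sub (g h : TensorL2 Ω) :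
    ∀ᵐ x ∂(volume.restrict Ω), tensorField (g - h) x = tensorField g x - tensorField h x := by
  have : ∀ i j, ∀ᵐ x ∂(volume.restrict Ω), (g i j - h i j) x = g i j x - h i j x :=
    fun i j => Lp.coeFn_sub (g i j) (h i j)
  filter_upwards [ae_all_iff.2 fun i => ae_all_iff.2 (this i)] with x hx
  ext i j
  exact hx i j

/-- Test functions together with their gradients. -/
def testGraph (Ω : Set (Vec d)) : Submodule ℝ (L2 Ω × TensorL2 Ω) where
  carrier := {z | ∃ w : Vec d → Vec d, IsTest Ω w ∧ z.1 =ᵐ[volume.restrict Ω] w ∧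
    ∀ i j, z.2 i j =ᵐ[volume.restrict Ω] fun x => partialDeriv j w x i}
  zero_mem' := by
    refine ⟨fun _ => 0, isTest_zero, Lp.coeFn_zero _ _ _, fun i j => ?_⟩
    filter_upwards [Lp.coeFn_zero ℝ 2 (volume.restrict Ω)] with x hx
    refine hx.trans ?_
    simp [partialDeriv]
  add_mem' := by
    rintro z z' ⟨w, hw, h1, h2⟩ ⟨w', hw', h1', h2'⟩
    refine ⟨_, hw.add hw', ?_, fun i j => ?_⟩
    · filter_upwards [Lp.coeFn_add z.1 z'.1, h1, h1'] with x hx hx1 hx2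
      rw [Prod.fst_add, hx, Pi.add_apply, hx1, hx2]
    · filter_upwards [Lp.coeFn_add (z.2 i j) (z'.2 i j), h2 i j, h2' i j] with x hx hx1 hx2
      rw [partialDeriv_add (hw.differentiable x) (hw'.differentiable x), PiLp.add_apply, ← hx1,
        ← hx2]
      exact hx
  smul_mem' := by
    rintro c z ⟨w, hw, h1, h2⟩
    refine ⟨_, hw.const_smul c, ?_, fun i j => ?_⟩
    · filter_upwards [Lp.coeFn_smul c z.1, h1] with x hx hx1
      rw [Prod.smul_fst, hx, Pi.smul_apply, hx1]
    · filter_upwards [Lp.coeFn_smul c (z.2 i j), h2 i j] with x hx hx1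
      rw [partialDeriv_const_smul (hw.differentiable x), PiLp.smul_apply, ← hx1]
      exact hx

/-- The fields in `H₀¹(Ω)ᵈ` together with their weak gradients. -/
def sobolevGraph (Ω : Set (Vec d)) : Submodule ℝ (L2 Ω × TensorL2 Ω) :=
  (testGraph Ω).topologicalClosure

/-- The density argument used throughout: the weak gradient identity, Korn's and Poincaré's
inequalities are closed conditions on a field and its gradient, so test functions suffice. -/
lemma sobolevGraph_induction {P : L2 Ω × TensorL2 Ω → Prop} (hP : IsClosed {z | P z})
    (h : ∀ z ∈ testGraph Ω, P z) {z : L2 Ω × TensorL2 Ω} (hz : z ∈ sobolevGraph Ω) : P z :=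
  closure_minimal (s := (testGraph Ω : Set (L2 Ω × TensorL2 Ω))) h hP hz

lemma IsWeakGradient.congr {u v : Vec d → Vec d} {G H : Vec d → Tensor d}
    (h : IsWeakGradient Ω u G) (huv : u =ᵐ[volume.restrict Ω] v)
    (hGH : G =ᵐ[volume.restrict Ω] H) : IsWeakGradient Ω v H := by
  refine ⟨fun i j => (h.1 i j).ae_eq (hGH.mono fun x hx => by simp only [hx]),
    fun ψ hψ i j => ?_⟩
  have e1 : ∫ x in Ω, u x i * partialDeriv j ψ x = ∫ x in Ω, v x i * partialDeriv j ψ x :=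
    integral_congr_ae (huv.mono fun x hx => by simp only [hx])
  have e2 : ∫ x in Ω, G x i j * ψ x = ∫ x in Ω, H x i j * ψ x :=
    integral_congr_ae (hGH.mono fun x hx => by simp only [hx])
  rw [← e1, ← e2, h.2 ψ hψ i j]

/-- For fixed `ψ`, `i`, `j` the defining identity equates two continuous linear functionals on the
graph, both `L²` inner products, so it passes to the closure. -/
lemma isWeakGradient_tensorField {z : L2 Ω × TensorL2 Ω} (hz : z ∈ sobolevGraph Ω) :
    IsWeakGradient Ω z.1 (tensorField z.2) := by
  -- The derivative `∂ⱼψ`, placed in slot `i` of a vector field, represents the left side as an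
  -- inner product in `L²(Ω)ᵈ`.
  refine ⟨fun i j => Lp.memLp (z.2 i j), fun ψ hψ i j => ?_⟩
  have hm1 : MemLp (fun x => EuclideanSpace.single i (partialDeriv j ψ x)) 2
      (volume.restrict Ω) := by
    refine MemLp.of_eval_piLp fun k => ?_
    by_cases h : k = i
    · subst h; simpa using (hψ.pderiv j).memLp Ω 2
    · simp [h]
  have hm2 := hψ.memLp Ω 2
  set a := hm1.toLp
  set b := hm2.toLp
  have ha : ∀ v : L2 Ω, inner ℝ a v = ∫ x in Ω, v x i * partialDeriv j ψ x := by
    intro v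
    rw [L2.inner_def]
    refine integral_congr_ae ?_
    filter_upwards [hm1.coeFn_toLp] with x hx
    rw [hx, EuclideanSpace.inner_single_left]
    simp [mul_comm]
  have hb : ∀ v : Lp ℝ 2 (volume.restrict Ω), inner ℝ b v = ∫ x in Ω, v x * ψ x := by
    intro v
    rw [L2.inner_def]
    refine integral_congr_ae ?_
    filter_upwards [hm2.coeFn_toLp] with x hx
    rw [hx]; simp
  have key : inner ℝ a z.1 = -inner ℝ b (z.2 i j) := by
    refine sobolevGraph_induction (P := fun z => inner ℝ a z.1 = -inner ℝ b (z.2 i j))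
      (isClosed_eq (by fun_prop) (by fun_prop)) ?_ hz
    rintro z ⟨w, hw, h1, h2⟩
    have e1 : ∫ x in Ω, z.1 x i * partialDeriv j ψ x = ∫ x in Ω, w x i * partialDeriv j ψ x :=
      integral_congr_ae (h1.mono fun x hx => by simp only [hx])
    have e2 : ∫ x in Ω, z.2 i j x * ψ x = ∫ x in Ω, partialDeriv j w x i * ψ x :=
      integral_congr_ae ((h2 i j).mono fun x hx => by simp only [hx])
    rw [ha, hb, e1, e2]
    exact hw.isWeakGradient.2 ψ hψ i j
  rw [ha, hb] at key
  exact key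

/-- Convergence in the `H¹` norm is convergence in the graph norm. This replaces the sequences in
the definition by a closed subspace of a Banach space. -/
lemma mem_H10_iff {u : L2 Ω} : u ∈ H10 Ω ↔ ∃ g, (u, g) ∈ sobolevGraph Ω := by
  constructor
  · rintro ⟨G, hG, w, hw, h1, h2⟩
    refine ⟨fun i j => (hG.1 i j).toLp, mem_closure_of_tendsto (b := atTop)
      (f := fun n => (((hw n).memLp Ω 2).toLp,
        fun i j => ((((hw n).pderiv j).coord i).memLp Ω 2).toLp)) ?_ ?_⟩
    · refine Tendsto.prodMk_nhds ?_ (tendsto_pi_nhds.2 fun i => tendsto_pi_nhds.2 fun j => ?_)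
      · rw [Lp.tendsto_Lp_iff_tendsto_eLpNorm']
        refine h1.congr fun n => ?_
        rw [← eLpNorm_neg]
        refine eLpNorm_congr_ae ?_
        filter_upwards [((hw n).memLp Ω 2).coeFn_toLp] with x hx
        simp [hx]
      · rw [Lp.tendsto_Lp_iff_tendsto_eLpNorm']
        refine (h2 i j).congr fun n => ?_
        rw [← eLpNorm_neg]
        refine eLpNorm_congr_ae ?_
        filter_upwards [((((hw n).pderiv j).coord i).memLp Ω 2).coeFn_toLp,
          (hG.1 i j).coeFn_toLp] with x hx hx'
        simp [hx, hx']
    · refine Eventually.of_forall fun n => ⟨w n, hw n, ((hw n).memLp Ω 2).coeFn_toLp, fun i j =>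
        ((((hw n).pderiv j).coord i).memLp Ω 2).coeFn_toLp⟩
  · rintro ⟨g, hg⟩
    refine ⟨tensorField g, isWeakGradient_tensorField hg, ?_⟩
    obtain ⟨z, hz, hlim⟩ := mem_closure_iff_seq_limit.1 hg
    choose w hw h1 h2 using hz
    refine ⟨w, hw, ?_, fun i j => ?_⟩
    · have := (continuous_fst.tendsto _).comp hlim
      rw [Lp.tendsto_Lp_iff_tendsto_eLpNorm'] at this
      refine this.congr fun n => ?_
      rw [← eLpNorm_neg]
      refine eLpNorm_congr_ae ?_
      filter_upwards [h1 n] with x hx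
      simp [hx]
    · have := ((continuous_apply j).tendsto _).comp (((continuous_apply i).tendsto _).comp
        ((continuous_snd.tendsto _).comp hlim))
      rw [Lp.tendsto_Lp_iff_tendsto_eLpNorm'] at this
      refine this.congr fun n => ?_
      rw [← eLpNorm_neg]
      refine eLpNorm_congr_ae ?_
      filter_upwards [h2 n i j] with x hx
      simp [hx, tensorField_apply]

/-- The fundamental lemma of the calculus of variations; square-integrable entries are integrable on
compact subsets, which have finite measure. -/
lemma IsWeakGradient.unique (hΩ : IsOpen Ω) {u : Vec d → Vec d} {G H : Vec d → Tensor d}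
    (hG : IsWeakGradient Ω u G) (hH : IsWeakGradient Ω u H) : G =ᵐ[volume.restrict Ω] H := by
  have : ∀ i j, ∀ᵐ x ∂(volume.restrict Ω), G x i j = H x i j := by
    intro i j
    have hm := (hG.1 i j).sub (hH.1 i j)
    have h0 := hΩ.ae_eq_zero_of_integral_contDiff_smul_eq_zero (μ := volume)
      (f := fun x => G x i j - H x i j) ?_ ?_
    · filter_upwards [(ae_restrict_iff' hΩ.measurableSet).2 h0] with x hx
      exact sub_eq_zero.1 hx
    · rw [locallyIntegrableOn_iff hΩ.isLocallyClosed]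
      intro k hk hkc
      have : IsFiniteMeasure (volume.restrict k) := ⟨by simpa using hkc.measure_lt_top⟩
      exact (hm.mono_measure (Measure.restrict_mono hk le_rfl)).integrable one_le_two
    · intro ψ h1 h2 h3
      have hψ : IsTest Ω ψ := ⟨h1, h2, h3⟩
      have e1 := hG.2 ψ hψ i j
      rw [hH.2 ψ hψ i j] at e1
      have hp := hψ.memLp Ω 2
      rw [← setIntegral_eq_integral_of_forall_compl_eq_zero (s := Ω)
        fun x hx => by rw [hψ.eq_zero hx, zero_smul]]
      have e2 : ∀ x, ψ x • (G x i j - H x i j) = G x i j * ψ x - H x i j * ψ x := fun x => by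
        rw [smul_eq_mul]; ring
      have e3 := integral_sub (integrable_mul_of_memLp (hG.1 i j) hp)
        (integrable_mul_of_memLp (hH.1 i j) hp)
      simp only [e2]
      linarith
  filter_upwards [ae_all_iff.2 fun i => ae_all_iff.2 (this i)] with x hx
  ext i j
  exact hx i j

lemma IsWeakGradient.weakGradient_ae_eq (hΩ : IsOpen Ω) {u : Vec d → Vec d} {G : Vec d → Tensor d}
    (hG : IsWeakGradient Ω u G) : weakGradient Ω u =ᵐ[volume.restrict Ω] G := by
  have h : ∃ G, IsWeakGradient Ω u G := ⟨G, hG⟩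
  rw [weakGradient, dif_pos h]
  exact h.choose_spec.unique hΩ hG

lemma weakGradient_ae_eq (hΩ : IsOpen Ω) {z : L2 Ω × TensorL2 Ω} (hz : z ∈ sobolevGraph Ω) :
    weakGradient Ω z.1 =ᵐ[volume.restrict Ω] tensorField z.2 :=
  (isWeakGradient_tensorField hz).weakGradient_ae_eq hΩ

/-- The trace of a square-integrable tensor field. -/
def traceL2 (Ω : Set (Vec d)) : L2 Ω × TensorL2 Ω →L[ℝ] Lp ℝ 2 (volume.restrict Ω) :=
  ∑ i, (ContinuousLinearMap.proj i).comp ((ContinuousLinearMap.proj i).comp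
    (ContinuousLinearMap.snd ℝ (L2 Ω) (TensorL2 Ω)))

/-- The divergence-free fields in `H₀¹(Ω)ᵈ` together with their weak gradients. -/
def solenoidalGraph (Ω : Set (Vec d)) : Submodule ℝ (L2 Ω × TensorL2 Ω) :=
  sobolevGraph Ω ⊓ (traceL2 Ω).ker

lemma isClosed_solenoidalGraph : IsClosed (solenoidalGraph Ω : Set (L2 Ω × TensorL2 Ω)) :=
  (Submodule.isClosed_topologicalClosure _).inter (ContinuousLinearMap.isClosed_ker _)

lemma traceL2_ae_eq (z : L2 Ω × TensorL2 Ω) :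
    traceL2 Ω z =ᵐ[volume.restrict Ω] fun x => (tensorField z.2 x).trace := by
  have : traceL2 Ω z = ∑ i, z.2 i i := by simp [traceL2]
  rw [this]
  filter_upwards [Lp.coeFn_finsetSum Finset.univ (fun i => z.2 i i)] with x hx
  rw [hx]
  simp [Matrix.trace, tensorField_apply]

lemma mem_admissible_iff (hΩ : IsOpen Ω) {u : L2 Ω} :
    u ∈ Admissible Ω ↔ ∃ g, (u, g) ∈ solenoidalGraph Ω := by
  have key : ∀ g, (u, g) ∈ sobolevGraph Ω → (traceL2 Ω (u, g) = 0 ↔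
      ∀ᵐ x ∂(volume.restrict Ω), divergence Ω u x = 0) := by
    intro g hg
    rw [Lp.ext_iff]
    have h0 := Lp.coeFn_zero ℝ 2 (volume.restrict Ω)
    constructor
    · intro h
      filter_upwards [h, h0, traceL2_ae_eq (u, g), weakGradient_ae_eq hΩ hg] with x h1 h2 h3 h4
      rw [divergence, h4, ← h3, h1, h2]; rfl
    · intro h
      filter_upwards [h, h0, traceL2_ae_eq (u, g), weakGradient_ae_eq hΩ hg] with x h1 h2 h3 h4
      rw [divergence, h4] at h1
      rw [h3, h2, h1]; rfl
  constructor
  · rintro ⟨h1, h2⟩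
    obtain ⟨g, hg⟩ := mem_H10_iff.1 h1
    exact ⟨g, hg, (key g hg).2 h2⟩
  · rintro ⟨g, hg, h2⟩
    exact ⟨mem_H10_iff.2 ⟨g, hg⟩, (key g hg).1 h2⟩

/-! ### Korn's inequality -/

lemma norm_sq_eq_integral (f : Lp ℝ 2 (volume.restrict Ω)) : ‖f‖ ^ 2 = ∫ x in Ω, f x * f x := by
  rw [← real_inner_self_eq_norm_sq, L2.inner_def]
  rfl

lemma norm_sq_eq_sum_integral (u : L2 Ω) : ‖u‖ ^ 2 = ∑ i, ∫ x in Ω, u x i * u x i := by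
  rw [← real_inner_self_eq_norm_sq, L2.inner_def, ← integral_finsetSum]
  · simp only [PiLp.inner_apply, RCLike.inner_apply, conj_trivial]
  · intro i _
    exact ((Lp.memLp u).eval_piLp i).integrable_mul ((Lp.memLp u).eval_piLp i)

/-- The square of the norm of the strain rate. -/
def strainNormSq (g : TensorL2 Ω) : ℝ :=
  ∑ i, ∑ j, ‖(1 / 2 : ℝ) • (g i j + g j i)‖ ^ 2

lemma continuous_strainNormSq : Continuous (strainNormSq (Ω := Ω)) := by
  unfold strainNormSq; fun_prop

/-- For test functions, two integrations by parts give `∑ ∫ ∂ⱼuᵢ ∂ᵢuⱼ = ‖div u‖²`. Hence `‖ε(u)‖² =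
‖∇u‖² / 2 + ‖div u‖² / 2`, and the last term is dropped. -/
lemma korn {z : L2 Ω × TensorL2 Ω} (hz : z ∈ sobolevGraph Ω) :
    ∑ i, ∑ j, ‖z.2 i j‖ ^ 2 ≤ 2 * strainNormSq z.2 := by
  refine sobolevGraph_induction (P := fun z => ∑ i, ∑ j, ‖z.2 i j‖ ^ 2 ≤ 2 * strainNormSq z.2)
    (isClosed_le (by fun_prop)
      (continuous_const.mul (continuous_strainNormSq.comp continuous_snd))) ?_ hz
  rintro z ⟨w, hw, -, h2⟩
  have hc : ∀ i j k l, inner ℝ (z.2 i j) (z.2 k l)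
      = ∫ x in Ω, partialDeriv j (fun y => w y i) x * partialDeriv l (fun y => w y k) x := by
    intro i j k l
    rw [L2.inner_def]
    refine integral_congr_ae ?_
    filter_upwards [h2 i j, h2 k l] with x h h'
    rw [h, h', partialDeriv_coord (hw.differentiable x), partialDeriv_coord (hw.differentiable x)]
    simp [mul_comm]
  have hswap : ∑ i, ∑ j, inner ℝ (z.2 i j) (z.2 j i) = ‖∑ i, z.2 i i‖ ^ 2 := by
    rw [← real_inner_self_eq_norm_sq, sum_inner]
    simp only [inner_sum]
    refine Finset.sum_congr rfl fun i _ => Finset.sum_congr rfl fun j _ => ?_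
    rw [hc, hc]
    exact (hw.coord i).integral_pderiv_swap (hw.coord j) i j
  have hexp : ∀ i j, ‖(1 / 2 : ℝ) • (z.2 i j + z.2 j i)‖ ^ 2
      = 1 / 4 * ‖z.2 i j‖ ^ 2 + 1 / 4 * ‖z.2 j i‖ ^ 2 + 1 / 2 * inner ℝ (z.2 i j) (z.2 j i) := by
    intro i j
    rw [norm_smul, mul_pow, norm_add_sq_real]; norm_num; ring
  have hT : ∑ i, ∑ j, ‖z.2 j i‖ ^ 2 = ∑ i, ∑ j, ‖z.2 i j‖ ^ 2 := Finset.sum_comm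
  have : strainNormSq z.2 = 1 / 2 * ∑ i, ∑ j, ‖z.2 i j‖ ^ 2 + 1 / 2 * ‖∑ i, z.2 i i‖ ^ 2 := by
    simp only [strainNormSq, hexp, Finset.sum_add_distrib, ← Finset.mul_sum]
    rw [hT, hswap]; ring
  rw [this]
  nlinarith [sq_nonneg ‖∑ i, z.2 i i‖]

lemma norm_sq_le_gradient (hΩ : MeasurableSet Ω) (j : Fin d) {R : ℝ} (hR : ∀ x ∈ Ω, |x j| ≤ R)
    {z : L2 Ω × TensorL2 Ω} (hz : z ∈ sobolevGraph Ω) :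
    ‖z.1‖ ^ 2 ≤ 4 * R ^ 2 * ∑ i, ∑ j, ‖z.2 i j‖ ^ 2 := by
  refine sobolevGraph_induction (P := fun z => ‖z.1‖ ^ 2 ≤ 4 * R ^ 2 * ∑ i, ∑ j, ‖z.2 i j‖ ^ 2)
    (isClosed_le (by fun_prop) (by fun_prop)) ?_ hz
  rintro z ⟨w, hw, h1, h2⟩
  rw [norm_sq_eq_sum_integral, Finset.mul_sum]
  refine Finset.sum_le_sum fun i _ => ?_
  have e1 : ∫ x in Ω, z.1 x i * z.1 x i = ∫ x in Ω, w x i * w x i :=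
    integral_congr_ae (h1.mono fun x hx => by simp only [hx])
  have e2 : ‖z.2 i j‖ ^ 2
      = ∫ x in Ω, partialDeriv j (fun y => w y i) x * partialDeriv j (fun y => w y i) x := by
    rw [norm_sq_eq_integral]
    refine integral_congr_ae ((h2 i j).mono fun x hx => ?_)
    simp only [hx, partialDeriv_coord (hw.differentiable x)]
  rw [e1]
  refine ((hw.coord i).poincare hΩ j hR).trans ?_
  rw [← e2]
  exact mul_le_mul_of_nonneg_left (Finset.single_le_sum (f := fun j => ‖z.2 i j‖ ^ 2)
    (fun _ _ => sq_nonneg _) (Finset.mem_univ j)) (by positivity)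

/-- Korn's and Poincaré's inequalities: the strain rate controls the `H¹` norm. -/
lemma exists_norm_sq_le_strain (hΩ : MeasurableSet Ω) (hb : Bornology.IsBounded Ω) (hd : 0 < d) :
    ∃ c > 0, ∀ z ∈ sobolevGraph Ω, c * ‖z‖ ^ 2 ≤ strainNormSq z.2 := by
  obtain ⟨R, hR⟩ := hb.exists_norm_le
  have hRj : ∀ x ∈ Ω, |x ⟨0, hd⟩| ≤ R := fun x hx =>
    (PiLp.norm_apply_le x (⟨0, hd⟩ : Fin d)).trans (hR x hx)
  -- The constant is `1 / (2 (1 + 4 R ^ 2))`: the factor 2 is Korn's, `4 R ^ 2` is Poincaré's.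
  refine ⟨1 / (2 + 8 * R ^ 2), by positivity, fun z hz => ?_⟩
  have h1 := korn hz
  have h2 := norm_sq_le_gradient hΩ _ hRj hz
  set S := ∑ i, ∑ j, ‖z.2 i j‖ ^ 2 with hS
  have hS0 : 0 ≤ S := by positivity
  have h3 : ‖z.2‖ ≤ Real.sqrt S := by
    refine (pi_norm_le_iff_of_nonneg (Real.sqrt_nonneg _)).2 fun i =>
      (pi_norm_le_iff_of_nonneg (Real.sqrt_nonneg _)).2 fun j => Real.le_sqrt_of_sq_le ?_
    exact (Finset.single_le_sum (f := fun j => ‖z.2 i j‖ ^ 2) (fun _ _ => sq_nonneg _)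
      (Finset.mem_univ j)).trans (Finset.single_le_sum (f := fun i => ∑ j, ‖z.2 i j‖ ^ 2)
      (fun _ _ => by positivity) (Finset.mem_univ i))
  have h4 : ‖z.2‖ ^ 2 ≤ S := by
    have := pow_le_pow_left₀ (norm_nonneg _) h3 2
    rwa [Real.sq_sqrt hS0] at this
  have h5 : ‖z‖ ^ 2 ≤ (1 + 4 * R ^ 2) * S := by
    rw [Prod.norm_def]
    rcases max_choice ‖z.1‖ ‖z.2‖ with h | h <;> rw [h] <;> nlinarith [mul_nonneg (sq_nonneg R) hS0]
  rw [one_div, inv_mul_le_iff₀ (by positivity)]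
  nlinarith [mul_le_mul_of_nonneg_left h1 (show 0 ≤ 1 + 4 * R ^ 2 by positivity)]

lemma strainNormSq_eq_integral (g : TensorL2 Ω) :
    strainNormSq g
      = ∫ x in Ω, contract (symPart (tensorField g x)) (symPart (tensorField g x)) := by
  have hm : ∀ i j, MemLp (fun x => symPart (tensorField g x) i j) 2 (volume.restrict Ω) := by
    intro i j
    simp only [symPart_apply, tensorField_apply]
    exact ((Lp.memLp (g i j)).add (Lp.memLp (g j i))).const_mul _
  have hi := fun i j => integrable_mul_of_memLp (hm i j) (hm i j)
  unfold contract strainNormSq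
  refine Eq.trans ?_ (integral_finsetSum _ fun i _ => integrable_finsetSum _ fun j _ =>
    hi i j).symm
  refine Finset.sum_congr rfl fun i _ => ?_
  refine Eq.trans ?_ (integral_finsetSum _ fun j _ => hi i j).symm
  refine Finset.sum_congr rfl fun j _ => ?_
  rw [norm_sq_eq_integral]
  refine integral_congr_ae ?_
  filter_upwards [Lp.coeFn_smul (1 / 2 : ℝ) (g i j + g j i), Lp.coeFn_add (g i j) (g j i)]
    with x h1 h2
  rw [h1, Pi.smul_apply, h2]
  simp [symPart_apply, tensorField_apply]

end SobolevGraph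

/-! ### Strain rates of fields in `H₀¹` -/

section StrainRate

variable {d : ℕ} {Ω : Set (Vec d)}

lemma strainRate_ae_eq (hΩ : IsOpen Ω) {u : L2 Ω} {g : TensorL2 Ω}
    (hz : (u, g) ∈ sobolevGraph Ω) :
    ∀ᵐ x ∂(volume.restrict Ω), strainRate Ω u x = symPart (tensorField g x) := by
  filter_upwards [weakGradient_ae_eq hΩ hz] with x hx
  rw [strainRate_eq_symPart, hx]

lemma smul_add_smul_mem_H10 {u v : L2 Ω} (hu : u ∈ H10 Ω) (hv : v ∈ H10 Ω) (a b : ℝ) :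
    a • u + b • v ∈ H10 Ω := by
  obtain ⟨g, hg⟩ := mem_H10_iff.1 hu
  obtain ⟨h, hh⟩ := mem_H10_iff.1 hv
  exact mem_H10_iff.2 ⟨a • g + b • h,
    (sobolevGraph Ω).add_mem ((sobolevGraph Ω).smul_mem a hg) ((sobolevGraph Ω).smul_mem b hh)⟩

lemma smul_add_smul_mem_admissible (hΩ : IsOpen Ω) {u v : L2 Ω} (hu : u ∈ Admissible Ω)
    (hv : v ∈ Admissible Ω) (a b : ℝ) : a • u + b • v ∈ Admissible Ω := by
  obtain ⟨g, hg⟩ := (mem_admissible_iff hΩ).1 hu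
  obtain ⟨h, hh⟩ := (mem_admissible_iff hΩ).1 hv
  exact (mem_admissible_iff hΩ).2 ⟨a • g + b • h, (solenoidalGraph Ω).add_mem
    ((solenoidalGraph Ω).smul_mem a hg) ((solenoidalGraph Ω).smul_mem b hh)⟩

lemma sub_mem_admissible (hΩ : IsOpen Ω) {u v : L2 Ω} (hu : u ∈ Admissible Ω)
    (hv : v ∈ Admissible Ω) : u - v ∈ Admissible Ω := by
  have := smul_add_smul_mem_admissible hΩ hu hv 1 (-1)
  rwa [one_smul, neg_one_smul, ← sub_eq_add_neg] at this

lemma strainRate_smul_add_smul (hΩ : IsOpen Ω) {u v : L2 Ω} (hu : u ∈ H10 Ω) (hv : v ∈ H10 Ω)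
    (a b : ℝ) : ∀ᵐ x ∂(volume.restrict Ω), strainRate Ω ↑(a • u + b • v) x
      = a • strainRate Ω u x + b • strainRate Ω v x := by
  obtain ⟨g, hg⟩ := mem_H10_iff.1 hu
  obtain ⟨h, hh⟩ := mem_H10_iff.1 hv
  have hs : (a • u + b • v, a • g + b • h) ∈ sobolevGraph Ω :=
    (sobolevGraph Ω).add_mem ((sobolevGraph Ω).smul_mem a hg) ((sobolevGraph Ω).smul_mem b hh)
  filter_upwards [strainRate_ae_eq hΩ hg, strainRate_ae_eq hΩ hh, strainRate_ae_eq hΩ hs,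
    tensorField_add (a • g) (b • h), tensorField_smul a g, tensorField_smul b h]
    with x h1 h2 h3 h4 h5 h6
  rw [h1, h2, h3, h4, h5, h6, symPart_add, symPart_smul, symPart_smul]

lemma strainRate_sub (hΩ : IsOpen Ω) {u v : L2 Ω} (hu : u ∈ H10 Ω) (hv : v ∈ H10 Ω) :
    ∀ᵐ x ∂(volume.restrict Ω), strainRate Ω ↑(u - v) x
      = strainRate Ω u x - strainRate Ω v x := by
  have h := strainRate_smul_add_smul hΩ hu hv 1 (-1)
  rw [one_smul, neg_one_smul, ← sub_eq_add_neg] at h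
  filter_upwards [h] with x hx
  rw [hx, one_smul, neg_one_smul, sub_eq_add_neg]

/-- A field with vanishing strain rate is zero by Korn and Poincaré. This converts strictness at the
level of tensors into strictness for velocities. -/
lemma eq_of_strainRate_ae_eq (hΩ : IsOpen Ω) (hb : Bornology.IsBounded Ω) (hd : 0 < d)
    {u v : L2 Ω} (hu : u ∈ H10 Ω) (hv : v ∈ H10 Ω)
    (h : ∀ᵐ x ∂(volume.restrict Ω), strainRate Ω u x = strainRate Ω v x) : u = v := by
  obtain ⟨c, hc, hK⟩ := exists_norm_sq_le_strain hΩ.measurableSet hb hd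
  have huv : u - v ∈ H10 Ω := by
    have := smul_add_smul_mem_H10 hu hv 1 (-1)
    rwa [one_smul, neg_one_smul, ← sub_eq_add_neg] at this
  obtain ⟨g, hg⟩ := mem_H10_iff.1 huv
  have h0 : strainNormSq g = 0 := by
    rw [strainNormSq_eq_integral]
    refine integral_eq_zero_of_ae ?_
    filter_upwards [h, strainRate_sub hΩ hu hv, strainRate_ae_eq hΩ hg] with x h1 h2 h3
    rw [← h3, h2, h1, sub_self]
    simp [contract]
  have h1 := hK _ hg
  rw [h0] at h1
  have h2 : ‖((u - v, g) : L2 Ω × TensorL2 Ω)‖ ^ 2 ≤ 0 := by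
    by_contra! h
    linarith [mul_pos hc h]
  have h3 : ((u - v, g) : L2 Ω × TensorL2 Ω) = 0 :=
    norm_eq_zero.1 (pow_eq_zero_iff two_ne_zero |>.1 (le_antisymm h2 (sq_nonneg _)))
  exact sub_eq_zero.1 (congrArg Prod.fst h3)

lemma memLp_strainRate {u : L2 Ω} (hu : u ∈ H10 Ω) (i j : Fin d) :
    MemLp (fun x => strainRate Ω u x i j) 2 (volume.restrict Ω) := by
  have h : ∃ G, IsWeakGradient Ω u G := ⟨_, hu.choose_spec.1⟩
  have hG : IsWeakGradient Ω u (weakGradient Ω u) := by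
    rw [weakGradient, dif_pos h]; exact h.choose_spec
  simp only [strainRate_eq_symPart, symPart_apply]
  exact ((hG.1 i j).add (hG.1 j i)).const_mul _

lemma integrable_contract {α : Type*} [MeasurableSpace α] {ν : Measure α} {A B : α → Tensor d}
    (hA : ∀ i j, MemLp (fun x => A x i j) 2 ν) (hB : ∀ i j, MemLp (fun x => B x i j) 2 ν) :
    Integrable (fun x => contract (A x) (B x)) ν :=
  integrable_finsetSum _ fun i _ => integrable_finsetSum _ fun j _ =>
    integrable_mul_of_memLp (hA i j) (hB i j)

lemma memLp_tensorInv {α : Type*} [MeasurableSpace α] {ν : Measure α} {A : α → Tensor d}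
    (hA : ∀ i j, MemLp (fun x => A x i j) 2 ν) : MemLp (fun x => tensorInv (A x)) 2 ν := by
  have h := integrable_contract hA hA
  rw [memLp_two_iff_integrable_sq]
  · simp only [tensorInv_sq]
    exact h.const_mul _
  · exact Real.continuous_sqrt.comp_aestronglyMeasurable
      (h.aestronglyMeasurable.const_mul (1 / 2))

lemma memLp_secondInv {u : L2 Ω} (hu : u ∈ H10 Ω) :
    MemLp (fun x => secondInv Ω u x) 2 (volume.restrict Ω) :=
  memLp_tensorInv (memLp_strainRate hu)

lemma integrable_inner_of_memLp {f : Vec d → Vec d} (hf : MemLp f 2 (volume.restrict Ω))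
    (u : L2 Ω) : IntegrableOn (fun x => inner ℝ (f x) (u x)) Ω := by
  refine (L2.integrable_inner (𝕜 := ℝ) hf.toLp u).congr ?_
  filter_upwards [hf.coeFn_toLp] with x hx
  rw [hx]

lemma integral_inner_eq {f : Vec d → Vec d} (hf : MemLp f 2 (volume.restrict Ω)) (u : L2 Ω) :
    ∫ x in Ω, inner ℝ (f x) (u x) = inner ℝ hf.toLp u := by
  rw [L2.inner_def]
  refine integral_congr_ae ?_
  filter_upwards [hf.coeFn_toLp] with x hx
  rw [hx]

end StrainRate

/-! ### Convexity of the energy and uniqueness of solutions -/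

section Uniqueness

variable {d : ℕ} {Ω : Set (Vec d)}

/-- The tangent inequalities at the combination `C`, towards `A` and `B`, are averaged; the linear
terms cancel since `a (A - C) + b (B - C) = 0`. -/
lemma le_convex_comb_of_subgradient {D m : Tensor d → ℝ}
    (h : ∀ A B, D A + 2 * m A * contract A (B - A) ≤ D B) (A B : Tensor d) {a b : ℝ}
    (ha : 0 ≤ a) (hb : 0 ≤ b) (hab : a + b = 1) : D (a • A + b • B) ≤ a * D A + b * D B := by
  set C := a • A + b • B with hC
  have h1 := mul_le_mul_of_nonneg_left (h C A) ha
  have h2 := mul_le_mul_of_nonneg_left (h C B) hb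
  have h3 : a * contract C (A - C) + b * contract C (B - C) = 0 := by
    rw [contract_sub_right, contract_sub_right]
    have : contract C C = a * contract C A + b * contract C B := by
      conv_lhs => rw [hC, ← hC, contract_add_right, contract_smul_right, contract_smul_right]
    linear_combination (-contract C C) * hab - this
  obtain rfl : b = 1 - a := by linarith
  linear_combination h1 + h2 - 2 * m C * h3

lemma lt_convex_comb_of_subgradient {D m : Tensor d → ℝ}
    (h : ∀ A B, A ≠ B → D A + 2 * m A * contract A (B - A) < D B) {A B : Tensor d} (hAB : A ≠ B)
    {a b : ℝ} (ha : 0 < a) (hb : 0 < b) (hab : a + b = 1) :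
    D (a • A + b • B) < a * D A + b * D B := by
  have hle : ∀ A B, D A + 2 * m A * contract A (B - A) ≤ D B := by
    intro A B
    by_cases hA : A = B
    · subst hA; simp [contract]
    · exact (h A B hA).le
  set C := a • A + b • B with hC
  obtain rfl : b = 1 - a := by linarith
  have hCA : C ≠ A := by
    intro h0
    have : (1 - a) • (B - A) = 0 := by
      rw [← sub_eq_zero] at h0
      rw [← h0, hC]; module
    rcases smul_eq_zero.1 this with h1 | h1
    · exact hb.ne' h1
    · exact hAB (sub_eq_zero.1 h1).symm
  have h1 := mul_lt_mul_of_pos_left (h C A hCA) ha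
  have h2 := mul_le_mul_of_nonneg_left (hle C B) hb.le
  have h3 : a * contract C (A - C) + (1 - a) * contract C (B - C) = 0 := by
    rw [contract_sub_right, contract_sub_right]
    have : contract C C = a * contract C A + (1 - a) * contract C B := by
      conv_lhs => rw [hC, ← hC, contract_add_right, contract_smul_right, contract_smul_right]
    linear_combination - this
  linear_combination h1 + h2 - 2 * m C * h3

variable {φ m : Vec d → ℝ → ℝ} {μlow : ℝ} {f : Vec d → Vec d}

/-- The energy density at a point, as a function of the strain rate tensor. -/
def energyDensity (φ : Vec d → ℝ → ℝ) (μlow : ℝ) (x : Vec d) (A : Tensor d) : ℝ :=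
  φ x (tensorInv A) + 2 * μlow * tensorInv A ^ 2

lemma integrable_energyDensity {u : L2 Ω} (hu : EnergyFinite Ω φ f u) :
    IntegrableOn (fun x => energyDensity φ μlow x (strainRate Ω u x)) Ω :=
  hu.1.add (hu.2.1.const_mul _)

lemma energy_eq {u : L2 Ω} (hu : EnergyFinite Ω φ f u) :
    energy Ω φ μlow f u = (∫ x in Ω, energyDensity φ μlow x (strainRate Ω u x))
      - ∫ x in Ω, inner ℝ (f x) (u x) := by
  rw [energy, ← integral_const_mul, ← integral_add hu.1 (hu.2.1.const_mul _)]
  rfl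

lemma convex_admissible (hΩ : IsOpen Ω) : Convex ℝ (Admissible Ω) :=
  fun _ hu _ hv a b _ _ _ => smul_add_smul_mem_admissible hΩ hu hv a b

lemma integral_inner_combo (hf : MemLp f 2 (volume.restrict Ω)) (u v : L2 Ω) (a b : ℝ) :
    ∫ x in Ω, inner ℝ (f x) ((a • u + b • v : L2 Ω) x)
      = a * (∫ x in Ω, inner ℝ (f x) (u x)) + b * ∫ x in Ω, inner ℝ (f x) (v x) := by
  rw [integral_inner_eq hf, integral_inner_eq hf, integral_inner_eq hf, inner_add_right,
    inner_smul_right, inner_smul_right]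

lemma convexOn_energy (hΩ : IsOpen Ω) (hf : MemLp f 2 (volume.restrict Ω))
    (hfin : ∀ u ∈ Admissible Ω, EnergyFinite Ω φ f u)
    (h : ∀ᵐ x ∂(volume.restrict Ω), ∀ A B, energyDensity φ μlow x A
      + 2 * m x (tensorInv A) * contract A (B - A) ≤ energyDensity φ μlow x B) :
    ConvexOn ℝ (Admissible Ω) (energy Ω φ μlow f) := by
  refine ⟨convex_admissible hΩ, fun u hu v hv a b ha hb hab => ?_⟩
  have hw := smul_add_smul_mem_admissible hΩ hu hv a b
  have iu := integrable_energyDensity (μlow := μlow) (hfin u hu)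
  have iv := integrable_energyDensity (μlow := μlow) (hfin v hv)
  have iw := integrable_energyDensity (μlow := μlow) (hfin _ hw)
  rw [energy_eq (hfin u hu), energy_eq (hfin v hv), energy_eq (hfin _ hw),
    integral_inner_combo hf, smul_eq_mul, smul_eq_mul]
  have : ∫ x in Ω, energyDensity φ μlow x (strainRate Ω ↑(a • u + b • v) x)
      ≤ ∫ x in Ω, (a * energyDensity φ μlow x (strainRate Ω u x)
        + b * energyDensity φ μlow x (strainRate Ω v x)) := by
    refine integral_mono_ae iw ((iu.const_mul a).add (iv.const_mul b)) ?_
    filter_upwards [h, strainRate_smul_add_smul hΩ hu.1 hv.1 a b] with x hx hs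
    rw [hs]
    exact le_convex_comb_of_subgradient hx _ _ ha hb hab
  rw [integral_add (iu.const_mul a) (iv.const_mul b), integral_const_mul,
    integral_const_mul] at this
  linarith

/-- Equality of the integrals in an almost everywhere inequality forces equality almost everywhere,
hence equal strain rates, hence `u = v`. -/
lemma strictConvexOn_energy (hΩ : IsOpen Ω) (hbd : Bornology.IsBounded Ω) (hd : 0 < d)
    (hf : MemLp f 2 (volume.restrict Ω)) (hfin : ∀ u ∈ Admissible Ω, EnergyFinite Ω φ f u)
    (h : ∀ᵐ x ∂(volume.restrict Ω), ∀ A B, A ≠ B → energyDensity φ μlow x A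
      + 2 * m x (tensorInv A) * contract A (B - A) < energyDensity φ μlow x B) :
    StrictConvexOn ℝ (Admissible Ω) (energy Ω φ μlow f) := by
  refine ⟨convex_admissible hΩ, fun u hu v hv huv a b ha hb hab => ?_⟩
  have hw := smul_add_smul_mem_admissible hΩ hu hv a b
  have iu := integrable_energyDensity (μlow := μlow) (hfin u hu)
  have iv := integrable_energyDensity (μlow := μlow) (hfin v hv)
  have iw := integrable_energyDensity (μlow := μlow) (hfin _ hw)
  rw [energy_eq (hfin u hu), energy_eq (hfin v hv), energy_eq (hfin _ hw),
    integral_inner_combo hf, smul_eq_mul, smul_eq_mul]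
  have key : ∀ᵐ x ∂(volume.restrict Ω),
      energyDensity φ μlow x (strainRate Ω ↑(a • u + b • v) x)
        ≤ a * energyDensity φ μlow x (strainRate Ω u x)
          + b * energyDensity φ μlow x (strainRate Ω v x) ∧
      (energyDensity φ μlow x (strainRate Ω ↑(a • u + b • v) x)
        = a * energyDensity φ μlow x (strainRate Ω u x)
          + b * energyDensity φ μlow x (strainRate Ω v x) →
        strainRate Ω u x = strainRate Ω v x) := by
    filter_upwards [h, strainRate_smul_add_smul hΩ hu.1 hv.1 a b] with x hx hs
    rw [hs]
    by_cases hA : strainRate Ω u x = strainRate Ω v x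
    · refine ⟨?_, fun _ => hA⟩
      rw [hA, ← add_smul, ← add_mul, hab, one_smul, one_mul]
    · have := lt_convex_comb_of_subgradient hx hA ha hb hab
      exact ⟨this.le, fun h => absurd h this.ne⟩
  have hle : ∫ x in Ω, energyDensity φ μlow x (strainRate Ω ↑(a • u + b • v) x)
      ≤ ∫ x in Ω, (a * energyDensity φ μlow x (strainRate Ω u x)
        + b * energyDensity φ μlow x (strainRate Ω v x)) :=
    integral_mono_ae iw ((iu.const_mul a).add (iv.const_mul b)) (key.mono fun _ h => h.1)
  have hlt : ∫ x in Ω, energyDensity φ μlow x (strainRate Ω ↑(a • u + b • v) x)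
      < ∫ x in Ω, (a * energyDensity φ μlow x (strainRate Ω u x)
        + b * energyDensity φ μlow x (strainRate Ω v x)) := by
    refine lt_of_le_of_ne hle fun heq => huv (eq_of_strainRate_ae_eq hΩ hbd hd hu.1 hv.1 ?_)
    have := (integral_eq_iff_of_ae_le iw ((iu.const_mul a).add (iv.const_mul b))
      (key.mono fun _ h => h.1)).1 heq
    filter_upwards [key, this] with x h1 h2
    exact h1.2 h2
  rw [integral_add (iu.const_mul a) (iv.const_mul b), integral_const_mul,
    integral_const_mul] at hlt
  linarith

/-- Adding the strict tangent inequalities from `A` to `B` and back cancels the densities and leaves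
strict monotonicity of the stress. Tested with `u₁ - u₂`, both equations have the same right side,
so the ordered integrands agree almost everywhere. The density is used only pointwise. -/
lemma IsVelocitySolution.unique (hΩ : IsOpen Ω) (hbd : Bornology.IsBounded Ω) (hd : 0 < d)
    (h : ∀ᵐ x ∂(volume.restrict Ω), ∀ A B, A ≠ B → energyDensity φ μlow x A
      + 2 * m x (tensorInv A) * contract A (B - A) < energyDensity φ μlow x B)
    {u₁ u₂ : L2 Ω} (h₁ : IsVelocitySolution Ω m f u₁) (h₂ : IsVelocitySolution Ω m f u₂) :
    u₁ = u₂ := by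
  obtain ⟨i1, e1⟩ := h₁.2 _ (sub_mem_admissible hΩ h₁.1 h₂.1)
  obtain ⟨i2, e2⟩ := h₂.2 _ (sub_mem_admissible hΩ h₁.1 h₂.1)
  have key : ∀ᵐ x ∂(volume.restrict Ω),
      viscousIntegrand Ω m u₂ ↑(u₁ - u₂) x ≤ viscousIntegrand Ω m u₁ ↑(u₁ - u₂) x ∧
      (viscousIntegrand Ω m u₂ ↑(u₁ - u₂) x = viscousIntegrand Ω m u₁ ↑(u₁ - u₂) x →
        strainRate Ω u₁ x = strainRate Ω u₂ x) := by
    filter_upwards [h, strainRate_sub hΩ h₁.1.1 h₂.1.1] with x hx hs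
    unfold viscousIntegrand
    rw [hs, secondInv_eq_tensorInv, secondInv_eq_tensorInv]
    by_cases hA : strainRate Ω u₁ x = strainRate Ω u₂ x
    · refine ⟨?_, fun _ => hA⟩
      rw [hA]
    · have h1 := hx _ _ hA
      have h2 := hx _ _ (Ne.symm hA)
      rw [← neg_sub, ← neg_one_smul ℝ, contract_smul_right] at h1
      have : 2 * m x (tensorInv (strainRate Ω u₂ x))
          * contract (strainRate Ω u₂ x) (strainRate Ω u₁ x - strainRate Ω u₂ x)
          < 2 * m x (tensorInv (strainRate Ω u₁ x))
          * contract (strainRate Ω u₁ x) (strainRate Ω u₁ x - strainRate Ω u₂ x) := by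
        linarith
      exact ⟨this.le, fun h => absurd h this.ne⟩
  refine eq_of_strainRate_ae_eq hΩ hbd hd h₁.1.1 h₂.1.1 ?_
  have := (integral_eq_iff_of_ae_le i2 i1 (key.mono fun _ h => h.1)).1 (e2.trans e1.symm)
  filter_upwards [key, this] with x h1 h2
  exact h1.2 h2

lemma IsStokesSolution.isVelocitySolution {u : L2 Ω} {p : Vec d → ℝ}
    (h : IsStokesSolution Ω m f u p) : IsVelocitySolution Ω m f u := by
  refine ⟨h.1, fun v hv => ⟨(h.2.2 v hv.1).1, ?_⟩⟩
  rw [← (h.2.2 v hv.1).2, integral_eq_zero_of_ae (f := fun x => p x * divergence Ω v x), sub_zero]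
  filter_upwards [hv.2] with x hx
  rw [hx, mul_zero]; rfl

end Uniqueness

/-! ### The ideal and the composite laws -/

section Laws

variable {d : ℕ} {Ω : Set (Vec d)} {μr τy : Vec d → ℝ} {f : Vec d → Vec d}

/-- The lower viscosity contributes the quadratic form `μlow A : A`, whose expansion about `A` is
exact with remainder `μlow |B - A| ^ 2`. This is the modulus of convexity behind both strictness and
existence. -/
lemma ideal_subgradient {μ τ : ℝ} (hμ : 0 < μ) (hτ : 0 < τ) (μlow : ℝ) (A B : Tensor d) :
    phiIdeal μ τ (tensorInv A) + 2 * μlow * tensorInv A ^ 2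
      + 2 * viscIdeal μlow μ τ (tensorInv A) * contract A (B - A)
      + μlow * contract (B - A) (B - A)
      ≤ phiIdeal μ τ (tensorInv B) + 2 * μlow * tensorInv B ^ 2 := by
  have h := tensor_subgradient (φ := phiIdeal μ τ) (μ := viscIdeal 0 μ τ)
    (fun s hs => viscIdeal_zero_nonneg hμ hτ hs)
    (fun s t hs _ => phiIdeal_subgradient hμ hτ hs t) A B
  rw [viscIdeal_split μlow, contract_self_sub, contract_self_eq A, contract_self_eq B]
  rw [contract_sub_right, contract_self_eq A] at h ⊢
  linarith

lemma ideal_energyDensity_le {μlow : ℝ} (hμlow : 0 ≤ μlow)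
    (hpos : ∀ᵐ x ∂(volume.restrict Ω), 0 < μr x ∧ 0 < τy x) :
    ∀ᵐ x ∂(volume.restrict Ω), ∀ A B : Tensor d,
      energyDensity (fun x s => phiIdeal (μr x) (τy x) s) μlow x A
        + 2 * viscIdeal μlow (μr x) (τy x) (tensorInv A) * contract A (B - A)
      ≤ energyDensity (fun x s => phiIdeal (μr x) (τy x) s) μlow x B := by
  filter_upwards [hpos] with x hx A B
  have := ideal_subgradient hx.1 hx.2 μlow A B
  have h2 := mul_nonneg hμlow (contract_self_nonneg (B - A))
  unfold energyDensity
  linarith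

lemma ideal_energyDensity_lt {μlow : ℝ} (hμlow : 0 < μlow)
    (hpos : ∀ᵐ x ∂(volume.restrict Ω), 0 < μr x ∧ 0 < τy x) :
    ∀ᵐ x ∂(volume.restrict Ω), ∀ A B : Tensor d, A ≠ B →
      energyDensity (fun x s => phiIdeal (μr x) (τy x) s) μlow x A
        + 2 * viscIdeal μlow (μr x) (τy x) (tensorInv A) * contract A (B - A)
      < energyDensity (fun x s => phiIdeal (μr x) (τy x) s) μlow x B := by
  filter_upwards [hpos] with x hx A B hAB
  have := ideal_subgradient hx.1 hx.2 μlow A B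
  have h2 := mul_pos hμlow (contract_self_pos (sub_ne_zero.2 hAB.symm))
  unfold energyDensity
  linarith

lemma composite_energyDensity_lt
    (hpos : ∀ᵐ x ∂(volume.restrict Ω), 0 < μr x ∧ 0 < τy x) :
    ∀ᵐ x ∂(volume.restrict Ω), ∀ A B : Tensor d, A ≠ B →
      energyDensity (fun x s => phiComposite (μr x) (τy x) s) 0 x A
        + 2 * viscComposite (μr x) (τy x) (tensorInv A) * contract A (B - A)
      < energyDensity (fun x s => phiComposite (μr x) (τy x) s) 0 x B := by
  filter_upwards [hpos] with x hx A B hAB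
  have := tensor_subgradient_strict (φ := phiComposite (μr x) (τy x))
    (μ := viscComposite (μr x) (τy x)) (fun s hs => viscComposite_pos hx.1 hx.2 hs)
    (fun s t hs ht hst => phiComposite_subgradient hx.1 hx.2 hs ht hst) hAB
  simpa [energyDensity] using this

lemma measurable_phiIdeal : Measurable fun p : ℝ × ℝ × ℝ => phiIdeal p.1 p.2.1 p.2.2 := by
  unfold phiIdeal
  exact Measurable.ite (measurableSet_le (by fun_prop) (by fun_prop)) (by fun_prop) (by fun_prop)

lemma measurable_phiComposite :
    Measurable fun p : ℝ × ℝ × ℝ => phiComposite p.1 p.2.1 p.2.2 := by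
  unfold phiComposite
  fun_prop

lemma phiIdeal_bounds (hpos : ∀ᵐ x ∂(volume.restrict Ω), 0 < μr x ∧ 0 < τy x) :
    ∀ᵐ x ∂(volume.restrict Ω), ∀ s, 0 ≤ s →
      0 ≤ phiIdeal (μr x) (τy x) s - phiIdeal (μr x) (τy x) 0 ∧
      phiIdeal (μr x) (τy x) s - phiIdeal (μr x) (τy x) 0 ≤ 2 * τy x * s := by
  filter_upwards [hpos] with x hx s hs
  exact ⟨phiIdeal_sub_nonneg hx.1 hx.2 s, phiIdeal_sub_le hx.1 hx.2 hs⟩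

lemma phiComposite_bounds (hpos : ∀ᵐ x ∂(volume.restrict Ω), 0 < μr x ∧ 0 < τy x) :
    ∀ᵐ x ∂(volume.restrict Ω), ∀ s, 0 ≤ s →
      0 ≤ phiComposite (μr x) (τy x) s - phiComposite (μr x) (τy x) 0 ∧
      phiComposite (μr x) (τy x) s - phiComposite (μr x) (τy x) 0 ≤ 2 * τy x * s := by
  filter_upwards [hpos] with x hx s hs
  exact ⟨phiComposite_sub_nonneg hx.1 hx.2 hs, phiComposite_sub_le hx.1 hx.2 hs⟩

/-- The increment of the density is at most `2 τ s`, a product of two `L²` functions. Integrability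
of the density at zero is thus needed only for the unshifted energy. -/
lemma integrable_density_sub {φ : ℝ → ℝ → ℝ → ℝ}
    (hφ : Measurable fun p : ℝ × ℝ × ℝ => φ p.1 p.2.1 p.2.2)
    (hμr : AEMeasurable μr (volume.restrict Ω)) (hτy : MemLp τy 2 (volume.restrict Ω))
    (h : ∀ᵐ x ∂(volume.restrict Ω), ∀ s, 0 ≤ s →
      0 ≤ φ (μr x) (τy x) s - φ (μr x) (τy x) 0 ∧
      φ (μr x) (τy x) s - φ (μr x) (τy x) 0 ≤ 2 * τy x * s)
    {s : Vec d → ℝ} (hs : MemLp s 2 (volume.restrict Ω)) (hs0 : ∀ x, 0 ≤ s x) :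
    IntegrableOn (fun x => φ (μr x) (τy x) (s x) - φ (μr x) (τy x) 0) Ω := by
  have hτm := hτy.aestronglyMeasurable.aemeasurable
  refine Integrable.mono' ((integrable_mul_of_memLp hτy hs).const_mul 2) ?_ ?_
  · exact ((hφ.comp_aemeasurable
      (hμr.prodMk (hτm.prodMk hs.aestronglyMeasurable.aemeasurable))).sub
      (hφ.comp_aemeasurable (hμr.prodMk (hτm.prodMk aemeasurable_const)))).aestronglyMeasurable
  · filter_upwards [h] with x hx
    obtain ⟨h1, h2⟩ := hx (s x) (hs0 x)
    rw [Real.norm_eq_abs, abs_of_nonneg h1]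
    linarith

lemma energyFinite_of_bounds {φ : ℝ → ℝ → ℝ → ℝ}
    (hφ : Measurable fun p : ℝ × ℝ × ℝ => φ p.1 p.2.1 p.2.2)
    (hμr : AEMeasurable μr (volume.restrict Ω)) (hτy : MemLp τy 2 (volume.restrict Ω))
    (hf : MemLp f 2 (volume.restrict Ω))
    (h : ∀ᵐ x ∂(volume.restrict Ω), ∀ s, 0 ≤ s →
      0 ≤ φ (μr x) (τy x) s - φ (μr x) (τy x) 0 ∧
      φ (μr x) (τy x) s - φ (μr x) (τy x) 0 ≤ 2 * τy x * s)
    (h0 : IntegrableOn (fun x => φ (μr x) (τy x) 0) Ω) {u : L2 Ω} (hu : u ∈ H10 Ω) :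
    EnergyFinite Ω (fun x s => φ (μr x) (τy x) s) f u := by
  refine ⟨?_, (memLp_secondInv hu).integrable_sq, integrable_inner_of_memLp hf u⟩
  have := (integrable_density_sub hφ hμr hτy h (memLp_secondInv hu)
    fun x => tensorInv_nonneg _).add h0
  refine this.congr (Eventually.of_forall fun x => ?_)
  simp

end Laws

/-! ### Existence of solutions for the ideal law with positive lower viscosity bound -/

section Existence

variable {d : ℕ} {Ω : Set (Vec d)} {μr τy : Vec d → ℝ} {f : Vec d → Vec d}

/-- A symmetric tensor is orthogonal to antisymmetric ones, so the stress pairs with a gradient as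
it does with the strain rate. -/
lemma contract_symPart_right (A B : Tensor d) :
    contract (symPart A) (symPart B) = contract (symPart A) B := by
  have h : ∑ i, ∑ j, (A i j + A j i) * B j i = ∑ i, ∑ j, (A i j + A j i) * B i j := by
    rw [Finset.sum_comm]
    simp only [add_comm]
  simp only [contract, symPart_apply]
  have e : ∀ i j, 1 / 2 * (A i j + A j i) * (1 / 2 * (B i j + B j i))
      = 1 / 4 * ((A i j + A j i) * B i j) + 1 / 4 * ((A i j + A j i) * B j i) := fun i j => by ring
  have e' : ∀ i j, 1 / 2 * (A i j + A j i) * B i j = 1 / 2 * ((A i j + A j i) * B i j) :=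
    fun i j => by ring
  simp only [e, e', Finset.sum_add_distrib, ← Finset.mul_sum]
  rw [h]; ring

lemma measurable_viscIdeal (μlow : ℝ) :
    Measurable fun p : ℝ × ℝ × ℝ => viscIdeal μlow p.1 p.2.1 p.2.2 := by
  unfold viscIdeal
  exact measurable_const.add (Measurable.ite (measurableSet_eq_fun (by fun_prop) (by fun_prop))
    (by fun_prop) (by fun_prop))

lemma memLp_symPart_tensorField (g : TensorL2 Ω) (i j : Fin d) :
    MemLp (fun x => symPart (tensorField g x) i j) 2 (volume.restrict Ω) := by
  simp only [symPart_apply, tensorField_apply]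
  exact ((Lp.memLp (g i j)).add (Lp.memLp (g j i))).const_mul _

/-- The stress tensor of the ideal law. -/
def idealStress (μlow : ℝ) (μr τy : Vec d → ℝ) (x : Vec d) (A : Tensor d) : Tensor d :=
  (2 * viscIdeal μlow (μr x) (τy x) (tensorInv A)) • A

/-- By saturation at yield, the entries are bounded by `2 μlow |A i j| + 2 τy`. -/
lemma memLp_idealStress {μlow : ℝ} (hμlow : 0 ≤ μlow)
    (hμr : AEMeasurable μr (volume.restrict Ω)) (hτy : MemLp τy 2 (volume.restrict Ω))
    (hpos : ∀ᵐ x ∂(volume.restrict Ω), 0 < μr x ∧ 0 < τy x) {A : Vec d → Tensor d}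
    (hA : ∀ i j, MemLp (fun x => A x i j) 2 (volume.restrict Ω)) (i j : Fin d) :
    MemLp (fun x => idealStress μlow μr τy x (A x) i j) 2 (volume.restrict Ω) := by
  refine (((hA i j).abs.const_mul (2 * μlow)).add (hτy.abs.const_mul 2)).mono ?_ ?_
  · have h1 := (measurable_viscIdeal μlow).comp_aemeasurable (hμr.prodMk
      (hτy.aestronglyMeasurable.aemeasurable.prodMk
        (memLp_tensorInv hA).aestronglyMeasurable.aemeasurable))
    exact ((h1.const_mul 2).mul (hA i j).aestronglyMeasurable.aemeasurable).aestronglyMeasurable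
  · filter_upwards [hpos] with x hx
    have h0 := tensorInv_nonneg (A x)
    have h1 := viscIdeal_zero_mul_le hx.1 hx.2 h0
    have h2 := viscIdeal_zero_nonneg hx.1 hx.2 h0
    have h3 := mul_le_mul_of_nonneg_left (abs_entry_le (A x) i j) h2
    have e : ‖idealStress μlow μr τy x (A x) i j‖
        = 2 * (μlow + viscIdeal 0 (μr x) (τy x) (tensorInv (A x))) * |A x i j| := by
      rw [idealStress, Matrix.smul_apply, smul_eq_mul, Real.norm_eq_abs, abs_mul,
        viscIdeal_split μlow, abs_of_nonneg (by positivity)]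
    rw [e]
    change _ ≤ |2 * μlow * |A x i j| + 2 * abs (τy x)|
    rw [abs_of_pos hx.2]
    refine le_trans ?_ (le_abs_self _)
    linarith

/-- The bound does not depend on `t` in `(0, 1]`: it is the dominating function for hemicontinuity
of the derivative of the energy. -/
lemma abs_idealStress_contract_le {μlow : ℝ} (hμlow : 0 ≤ μlow) {x : Vec d} (hμ : 0 < μr x)
    (hτ : 0 < τy x) (A B : Tensor d) {t : ℝ} (ht0 : 0 < t) (ht1 : t ≤ 1) :
    |contract (idealStress μlow μr τy x (A + t • B)) B|
      ≤ 2 * (τy x * tensorInv B)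
        + 4 * μlow * (tensorInv A * tensorInv B + tensorInv B * tensorInv B) := by
  have hB := tensorInv_nonneg B
  have h0 := tensorInv_nonneg (A + t • B)
  have h1 := viscIdeal_zero_mul_le hμ hτ h0
  have h2 := viscIdeal_zero_nonneg hμ hτ h0
  have h3 := mul_le_mul_of_nonneg_left (abs_contract_le (A + t • B) B) h2
  have h4 : viscIdeal 0 (μr x) (τy x) (tensorInv (A + t • B))
      * (2 * tensorInv (A + t • B) * tensorInv B) ≤ τy x * tensorInv B := by
    have := mul_le_mul_of_nonneg_right h1 hB
    linarith
  have h5 : |contract (A + t • B) B|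
      ≤ 2 * (tensorInv A * tensorInv B + tensorInv B * tensorInv B) := by
    rw [contract_add_left, contract_smul_left]
    refine (abs_add_le _ _).trans ?_
    rw [abs_mul, abs_of_pos ht0]
    have h6 := abs_contract_le A B
    have h7 := mul_le_mul ht1 (abs_contract_le B B) (abs_nonneg _) zero_le_one
    linarith
  have h6 := mul_le_mul_of_nonneg_left h5 hμlow
  rw [idealStress, contract_smul_left, abs_mul, viscIdeal_split μlow,
    abs_of_nonneg (by positivity)]
  linarith

lemma tendsto_idealStress_contract {μlow : ℝ} {x : Vec d} (hμ : 0 < μr x)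
    (hτ : 0 < τy x) (A B : Tensor d) :
    Tendsto (fun t : ℝ => contract (idealStress μlow μr τy x (A + t • B)) B) (𝓝[>] 0)
      (𝓝 (contract (idealStress μlow μr τy x A) B)) := by
  have hl : Continuous fun t : ℝ => A + t • B := by fun_prop
  have e : ∀ t : ℝ, contract (idealStress μlow μr τy x (A + t • B)) B
      = 2 * (μlow + τy x * μr x / max (τy x) (2 * μr x * tensorInv (A + t • B)))
        * contract (A + t • B) B := by
    intro t
    rw [idealStress, contract_smul_left, viscIdeal_eq hμ hτ _ (tensorInv_nonneg _)]
  have hc : Continuous fun t : ℝ => contract (idealStress μlow μr τy x (A + t • B)) B := by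
    simp only [e]
    refine (continuous_const.mul (continuous_const.add (continuous_const.div
      (continuous_const.max (continuous_const.mul (continuous_tensorInv.comp hl))) fun t =>
        (lt_max_of_lt_left hτ).ne'))).mul (continuous_contract.comp (hl.prodMk continuous_const))
  have := (hc.tendsto 0).mono_left (nhdsWithin_le_nhds (s := Set.Ioi 0))
  simpa using this

/-- The derivative of the energy at `z`, as a functional on divergence-free fields. -/
def idealResidual (μlow : ℝ) (hμlow : 0 ≤ μlow)
    (hμr : AEMeasurable μr (volume.restrict Ω)) (hτy : MemLp τy 2 (volume.restrict Ω))
    (hf : MemLp f 2 (volume.restrict Ω))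
    (hpos : ∀ᵐ x ∂(volume.restrict Ω), 0 < μr x ∧ 0 < τy x) (z : solenoidalGraph Ω) :
    solenoidalGraph Ω →L[ℝ] ℝ :=
  ((∑ i, ∑ j, (innerSL ℝ (memLp_idealStress hμlow hμr hτy hpos
      (memLp_symPart_tensorField z.1.2) i j).toLp).comp
      ((ContinuousLinearMap.proj j).comp ((ContinuousLinearMap.proj i).comp
        (ContinuousLinearMap.snd ℝ (L2 Ω) (TensorL2 Ω)))))
    - (innerSL ℝ hf.toLp).comp (ContinuousLinearMap.fst ℝ (L2 Ω) (TensorL2 Ω))).comp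
    (solenoidalGraph Ω).subtypeL

lemma idealResidual_apply {μlow : ℝ} (hμlow : 0 ≤ μlow)
    (hμr : AEMeasurable μr (volume.restrict Ω)) (hτy : MemLp τy 2 (volume.restrict Ω))
    (hf : MemLp f 2 (volume.restrict Ω))
    (hpos : ∀ᵐ x ∂(volume.restrict Ω), 0 < μr x ∧ 0 < τy x) (z v : solenoidalGraph Ω) :
    idealResidual μlow hμlow hμr hτy hf hpos z v
      = (∫ x in Ω, contract (idealStress μlow μr τy x (symPart (tensorField z.1.2 x)))
          (symPart (tensorField v.1.2 x))) - ∫ x in Ω, inner ℝ (f x) (v.1.1 x) := by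
  have hm := fun i j => memLp_idealStress hμlow hμr hτy hpos
    (memLp_symPart_tensorField z.1.2) i j
  have e1 : ∀ x, contract (idealStress μlow μr τy x (symPart (tensorField z.1.2 x)))
      (symPart (tensorField v.1.2 x))
      = contract (idealStress μlow μr τy x (symPart (tensorField z.1.2 x)))
        (tensorField v.1.2 x) := by
    intro x
    rw [idealStress, contract_smul_left, contract_smul_left, contract_symPart_right]
  have e2 : idealResidual μlow hμlow hμr hτy hf hpos z v
      = (∑ i, ∑ j, inner ℝ (hm i j).toLp (v.1.2 i j)) - inner ℝ hf.toLp v.1.1 := by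
    simp [idealResidual]
  have hi := fun i j => integrable_mul_of_memLp (hm i j) (Lp.memLp (v.1.2 i j))
  rw [e2, ← integral_inner_eq hf]
  simp only [e1]
  congr 1
  unfold contract
  refine Eq.trans ?_ (integral_finsetSum _ fun i _ => integrable_finsetSum _ fun j _ =>
    hi i j).symm
  refine Finset.sum_congr rfl fun i _ => ?_
  refine Eq.trans ?_ (integral_finsetSum _ fun j _ => hi i j).symm
  refine Finset.sum_congr rfl fun j _ => ?_
  rw [L2.inner_def]
  refine integral_congr_ae ?_
  filter_upwards [(hm i j).coeFn_toLp] with x hx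
  rw [hx]
  simp [mul_comm]

/-- The energy of the ideal law, shifted so that the density vanishes at zero strain rate. -/
def idealShiftedDensity (μlow : ℝ) (μr τy : Vec d → ℝ) (x : Vec d) (A : Tensor d) : ℝ :=
  phiIdeal (μr x) (τy x) (tensorInv A) - phiIdeal (μr x) (τy x) 0 + 2 * μlow * tensorInv A ^ 2

lemma integrable_idealShiftedDensity (μlow : ℝ)
    (hμr : AEMeasurable μr (volume.restrict Ω)) (hτy : MemLp τy 2 (volume.restrict Ω))
    (hpos : ∀ᵐ x ∂(volume.restrict Ω), 0 < μr x ∧ 0 < τy x) {A : Vec d → Tensor d}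
    (hA : ∀ i j, MemLp (fun x => A x i j) 2 (volume.restrict Ω)) :
    IntegrableOn (fun x => idealShiftedDensity μlow μr τy x (A x)) Ω :=
  (integrable_density_sub measurable_phiIdeal hμr hτy (phiIdeal_bounds hpos) (memLp_tensorInv hA)
    fun _ => tensorInv_nonneg _).add ((memLp_tensorInv hA).integrable_sq.const_mul _)

theorem exists_isVelocitySolution_ideal (hΩ : IsOpen Ω) (hb : Bornology.IsBounded Ω) (hd : 0 < d)
    {μlow : ℝ} (hμlow : 0 < μlow)
    (hμr : AEMeasurable μr (volume.restrict Ω)) (hτy : MemLp τy 2 (volume.restrict Ω))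
    (hf : MemLp f 2 (volume.restrict Ω))
    (hpos : ∀ᵐ x ∂(volume.restrict Ω), 0 < μr x ∧ 0 < τy x) :
    ∃ u : L2 Ω, IsVelocitySolution Ω (fun x s => viscIdeal μlow (μr x) (τy x) s) f u := by
  obtain ⟨c, hc, hK⟩ := exists_norm_sq_le_strain hΩ.measurableSet hb hd
  have : CompleteSpace (solenoidalGraph Ω) :=
    (isClosed_solenoidalGraph (Ω := Ω)).completeSpace_coe
  have hS := fun z : solenoidalGraph Ω => memLp_symPart_tensorField z.1.2
  have hstress := fun z : solenoidalGraph Ω =>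
    memLp_idealStress hμlow.le hμr hτy hpos (hS z)
  have hDi := fun z : solenoidalGraph Ω =>
    integrable_idealShiftedDensity μlow hμr hτy hpos (hS z)
  obtain ⟨z, hz⟩ : ∃ z : solenoidalGraph Ω, ∀ v,
      idealResidual μlow hμlow.le hμr hτy hf hpos z v = 0 := by
    -- The functional is the energy minus `∫ φ(0)`, which is finite even where the energy itself is
    -- not. Its modulus is `μlow` times the Korn–Poincaré constant.
    refine exists_subgradient_eq_zero
      (fun z => (∫ x in Ω, idealShiftedDensity μlow μr τy x (symPart (tensorField z.1.2 x)))
        - ∫ x in Ω, inner ℝ (f x) (z.1.1 x))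
      (idealResidual μlow hμlow.le hμr hτy hf hpos) (mul_pos hμlow hc) ?_ ?_
    · intro y z
      rw [idealResidual_apply]
      have i1 := integrable_contract (hstress y) (hS (z - y))
      have i2 := integrable_contract (hS (z - y)) (hS (z - y))
      have hsub : ∀ᵐ x ∂(volume.restrict Ω), symPart (tensorField (z - y).1.2 x)
          = symPart (tensorField z.1.2 x) - symPart (tensorField y.1.2 x) := by
        filter_upwards [tensorField_sub z.1.2 y.1.2] with x hx
        rw [← symPart_sub, ← hx]; rfl
      have hint : (∫ x in Ω, idealShiftedDensity μlow μr τy x (symPart (tensorField y.1.2 x)))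
          + (∫ x in Ω, contract (idealStress μlow μr τy x (symPart (tensorField y.1.2 x)))
              (symPart (tensorField (z - y).1.2 x)))
          + μlow * strainNormSq (z - y).1.2
          ≤ ∫ x in Ω, idealShiftedDensity μlow μr τy x (symPart (tensorField z.1.2 x)) := by
        have i3 : Integrable (fun x => idealShiftedDensity μlow μr τy x
            (symPart (tensorField y.1.2 x)) + contract (idealStress μlow μr τy x
            (symPart (tensorField y.1.2 x))) (symPart (tensorField (z - y).1.2 x)))
            (volume.restrict Ω) := (hDi y).add i1
        rw [strainNormSq_eq_integral, ← integral_const_mul, ← integral_add (hDi y) i1,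
          ← integral_add i3 (i2.const_mul _)]
        refine integral_mono_ae (i3.add (i2.const_mul _)) (hDi z) ?_
        filter_upwards [hsub, hpos] with x hx hp
        have := ideal_subgradient hp.1 hp.2 μlow (symPart (tensorField y.1.2 x))
          (symPart (tensorField z.1.2 x))
        rw [hx, idealStress, contract_smul_left]
        unfold idealShiftedDensity
        linarith
      have hin : ∫ x in Ω, inner ℝ (f x) ((z - y).1.1 x)
          = (∫ x in Ω, inner ℝ (f x) (z.1.1 x)) - ∫ x in Ω, inner ℝ (f x) (y.1.1 x) := by
        rw [integral_inner_eq hf, integral_inner_eq hf, integral_inner_eq hf, ← inner_sub_right]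
        rfl
      have hk := mul_le_mul_of_nonneg_left (hK (z - y).1 (z - y).2.1) hμlow.le
      have hn : ‖z - y‖ = ‖(z - y).1‖ := rfl
      rw [hin, hn]
      linarith
    -- Hemicontinuity, by dominated convergence along the ray `z + t • v`.
    · intro z v
      simp only [idealResidual_apply]
      refine Tendsto.sub_const ?_ _
      have hadd : ∀ t : ℝ, ∀ᵐ x ∂(volume.restrict Ω), symPart (tensorField (z + t • v).1.2 x)
          = symPart (tensorField z.1.2 x) + t • symPart (tensorField v.1.2 x) := by
        intro t
        filter_upwards [tensorField_add z.1.2 (t • v.1.2), tensorField_smul t v.1.2] with x h1 h2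
        rw [← symPart_smul, ← symPart_add, ← h2, ← h1]; rfl
      have hti := integrable_mul_of_memLp hτy (memLp_tensorInv (hS v))
      have hzv := integrable_mul_of_memLp (memLp_tensorInv (hS z)) (memLp_tensorInv (hS v))
      have hvv := integrable_mul_of_memLp (memLp_tensorInv (hS v)) (memLp_tensorInv (hS v))
      have hae : ∀ t : ℝ, (fun x => contract (idealStress μlow μr τy x
            (symPart (tensorField (z + t • v).1.2 x))) (symPart (tensorField v.1.2 x)))
          =ᵐ[volume.restrict Ω] fun x => contract (idealStress μlow μr τy x
            (symPart (tensorField z.1.2 x) + t • symPart (tensorField v.1.2 x)))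
            (symPart (tensorField v.1.2 x)) := by
        intro t
        filter_upwards [hadd t] with x hx
        rw [hx]
      rw [tendsto_congr fun t => integral_congr_ae (hae t)]
      refine tendsto_integral_filter_of_dominated_convergence _ ?_ ?_
        ((hti.const_mul 2).add ((hzv.add hvv).const_mul (4 * μlow))) ?_
      · exact Eventually.of_forall fun t =>
          (integrable_contract (hstress (z + t • v)) (hS v)).aestronglyMeasurable.congr (hae t)
      · filter_upwards [Ioc_mem_nhdsGT (zero_lt_one (α := ℝ))] with t ht
        filter_upwards [hpos] with x hp
        exact abs_idealStress_contract_le hμlow.le hp.1 hp.2 _ _ ht.1 ht.2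
      · filter_upwards [hpos] with x hp
        exact tendsto_idealStress_contract hp.1 hp.2 _ _
  refine ⟨z.1.1, (mem_admissible_iff hΩ).2 ⟨z.1.2, z.2⟩, fun v hv => ?_⟩
  obtain ⟨g, hg⟩ := (mem_admissible_iff hΩ).1 hv
  have h0 := hz ⟨(v, g), hg⟩
  rw [idealResidual_apply] at h0
  have hae : (fun x => contract (idealStress μlow μr τy x (symPart (tensorField z.1.2 x)))
      (symPart (tensorField g x))) =ᵐ[volume.restrict Ω]
      viscousIntegrand Ω (fun x s => viscIdeal μlow (μr x) (τy x) s) z.1.1 v := by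
    filter_upwards [strainRate_ae_eq hΩ hg.1, strainRate_ae_eq hΩ (g := z.1.2) z.2.1]
      with x h1 h2
    rw [viscousIntegrand, secondInv_eq_tensorInv, h1, h2, idealStress, contract_smul_left]
  refine ⟨(integrable_contract (hstress z) (memLp_symPart_tensorField g)).congr hae, ?_⟩
  rw [← integral_congr_ae hae]
  exact sub_eq_zero.1 h0

end Existence

/-! ### Smooth solutions with prescribed stress -/

section SmoothSolutions

variable {d : ℕ} {Ω : Set (Vec d)}

/-- The classical gradient. -/
def classicalGradient (w : Vec d → Vec d) (x : Vec d) : Tensor d :=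
  Matrix.of fun i j => partialDeriv j w x i

lemma IsTest.mem_H10 {w : Vec d → Vec d} (hw : IsTest Ω w) : (hw.memLp Ω 2).toLp ∈ H10 Ω := by
  refine mem_H10_iff.2 ⟨fun i j => (((hw.pderiv j).coord i).memLp Ω 2).toLp,
    subset_closure ⟨w, hw, (hw.memLp Ω 2).coeFn_toLp, fun i j =>
      (((hw.pderiv j).coord i).memLp Ω 2).coeFn_toLp⟩⟩

lemma IsTest.weakGradient_ae_eq (hΩ : IsOpen Ω) {w : Vec d → Vec d} (hw : IsTest Ω w) :
    weakGradient Ω (hw.memLp Ω 2).toLp =ᵐ[volume.restrict Ω] classicalGradient w :=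
  (hw.isWeakGradient.congr (hw.memLp Ω 2).coeFn_toLp.symm
    (EventuallyEq.refl _ _)).weakGradient_ae_eq hΩ

lemma IsTest.mem_admissible (hΩ : IsOpen Ω) {w : Vec d → Vec d} (hw : IsTest Ω w)
    (h : ∀ x, (classicalGradient w x).trace = 0) : (hw.memLp Ω 2).toLp ∈ Admissible Ω := by
  refine ⟨hw.mem_H10, ?_⟩
  filter_upwards [hw.weakGradient_ae_eq hΩ] with x hx
  rw [divergence, hx, h]

/-- The negative divergence of a smooth stress field. -/
def stressForce (S : Vec d → Tensor d) (x : Vec d) : Vec d :=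
  WithLp.toLp 2 fun i => -∑ j, partialDeriv j (fun y => S y i j) x

lemma memLp_stressForce {S : Vec d → Tensor d} (hS : ∀ i j, IsTest Ω fun x => S x i j) :
    MemLp (stressForce S) 2 (volume.restrict Ω) := by
  refine MemLp.of_eval_piLp fun i => ?_
  exact (memLp_finsetSum _ fun j _ => ((hS i j).pderiv j).memLp Ω 2).neg

/-- With `-div S` as force, the momentum equation is the definition of the weak gradient of `v`
tested with the entries of `S`. Only the stress of `u` matters, so fields with the same stress solve
the same problem. -/
lemma isStokesSolution_of_stress {m : Vec d → ℝ → ℝ} {u : L2 Ω}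
    (hu : u ∈ Admissible Ω) {S : Vec d → Tensor d} (hS : ∀ i j, IsTest Ω fun x => S x i j)
    (hsymm : ∀ x, symPart (S x) = S x)
    (hm : ∀ᵐ x ∂(volume.restrict Ω), (2 * m x (secondInv Ω u x)) • strainRate Ω u x = S x) :
    IsStokesSolution Ω m (stressForce S) u 0 := by
  refine ⟨hu, MemLp.zero, fun v hv => ?_⟩
  have h : ∃ G, IsWeakGradient Ω v G := ⟨_, hv.choose_spec.1⟩
  have hG : IsWeakGradient Ω v (weakGradient Ω v) := by
    rw [weakGradient, dif_pos h]; exact h.choose_spec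
  have hSm := fun i j => (hS i j).memLp Ω 2
  have hi := fun i j => integrable_mul_of_memLp (hSm i j) (hG.1 i j)
  have hae : (fun x => contract (S x) (weakGradient Ω v x)) =ᵐ[volume.restrict Ω]
      viscousIntegrand Ω m u v := by
    filter_upwards [hm] with x hx
    rw [viscousIntegrand, ← contract_smul_left, hx, strainRate_eq_symPart]
    conv_rhs => rw [← hsymm, contract_symPart_right, hsymm]
  refine ⟨(integrable_contract hSm hG.1).congr hae, ?_⟩
  rw [← integral_congr_ae hae]
  have e1 : ∫ x in Ω, contract (S x) (weakGradient Ω v x)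
      = ∑ i, ∑ j, ∫ x in Ω, S x i j * weakGradient Ω v x i j := by
    unfold contract
    refine (integral_finsetSum _ fun i _ => integrable_finsetSum _ fun j _ => hi i j).trans ?_
    exact Finset.sum_congr rfl fun i _ => integral_finsetSum _ fun j _ => hi i j
  have hv2 := fun i => (Lp.memLp v).eval_piLp i
  have hj := fun i j => integrable_mul_of_memLp (hv2 i) (((hS i j).pderiv j).memLp Ω 2)
  have e2 : ∫ x in Ω, inner ℝ (stressForce S x) (v x)
      = ∑ i, ∑ j, -∫ x in Ω, v x i * partialDeriv j (fun y => S y i j) x := by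
    have : ∀ x, inner ℝ (stressForce S x) (v x)
        = ∑ i, ∑ j, -(v x i * partialDeriv j (fun y => S y i j) x) := by
      intro x
      simp [PiLp.inner_apply, stressForce, Finset.mul_sum]
    simp only [this]
    refine (integral_finsetSum _ fun i _ => integrable_finsetSum _ fun j _ => (hj i j).neg).trans ?_
    refine Finset.sum_congr rfl fun i _ =>
      (integral_finsetSum _ fun j _ => (hj i j).neg).trans ?_
    exact Finset.sum_congr rfl fun j _ => integral_neg _
  have e3 : ∫ x in Ω, (0 : Vec d → ℝ) x * divergence Ω v x = 0 := by simp
  rw [e1, e2, e3, sub_zero]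
  refine Finset.sum_congr rfl fun i _ => Finset.sum_congr rfl fun j _ => ?_
  rw [hG.2 _ (hS i j) i j, neg_neg]
  simp only [mul_comm]

end SmoothSolutions

/-! ### Angular velocity profiles -/

section Profiles

/-- A plateau function, equal to one on `[3/8, 5/8]` and supported in `[1/4, 3/4]`. -/
def wideBump : ContDiffBump (1 / 2 : ℝ) := ⟨1 / 8, 1 / 4, by norm_num, by norm_num⟩

/-- A bump function supported in the plateau of `wideBump`. -/
def narrowBump : ContDiffBump (1 / 2 : ℝ) := ⟨1 / 16, 1 / 8, by norm_num, by norm_num⟩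

/-- The shear profile with shear rate `c`. -/
def shear (c : ℝ → ℝ) (t : ℝ) : ℝ := c t / (t * Real.sqrt (1 - t))

/-- The angular velocity with shear profile `shear c`. -/
def angularVelocity (c : ℝ → ℝ) (t : ℝ) : ℝ := ∫ s in (0 : ℝ)..t, shear c s

/-- Smooth nonnegative shear rates supported in `[1/4, 3/4]`. -/
structure IsShearRate (c : ℝ → ℝ) : Prop where
  contDiff : ContDiff ℝ ∞ c
  nonneg : ∀ t, 0 ≤ c t
  eq_zero : ∀ t, 1 / 4 ≤ |t - 1 / 2| → c t = 0

lemma isShearRate_wideBump : IsShearRate wideBump :=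
  ⟨wideBump.contDiff, fun _ => wideBump.nonneg, fun _ h => wideBump.zero_of_le_dist h⟩

lemma isShearRate_wideBump_add_narrowBump : IsShearRate fun t => wideBump t + narrowBump t :=
  ⟨wideBump.contDiff.add narrowBump.contDiff, fun _ => add_nonneg wideBump.nonneg narrowBump.nonneg,
    fun t h => by
      rw [wideBump.zero_of_le_dist h, narrowBump.zero_of_le_dist, add_zero]
      exact le_trans (by norm_num [narrowBump]) h⟩

variable {c : ℝ → ℝ}

/-- The denominator degenerates at `0` and `1`, but `c` vanishes near both. -/
lemma IsShearRate.contDiff_shear (hc : IsShearRate c) : ContDiff ℝ ∞ (shear c) := by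
  rw [contDiff_iff_contDiffAt]
  intro t
  by_cases ht : |t - 1 / 2| < 1 / 2
  · obtain ⟨h1, h2⟩ := abs_lt.1 ht
    have h3 : 0 < 1 - t := by linarith
    have h4 : 0 < t := by linarith
    refine hc.contDiff.contDiffAt.div (contDiffAt_id.mul
      ((contDiffAt_const.sub contDiffAt_id).sqrt h3.ne')) (by positivity)
  · have h : ∀ᶠ s in 𝓝 t, shear c s = 0 := by
      have ho : ∀ᶠ s in 𝓝 t, 1 / 4 < |s - 1 / 2| :=
        (by fun_prop : Continuous fun s : ℝ => |s - 1 / 2|).tendsto t |>.eventually_const_lt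
          (by push Not at ht; linarith)
      filter_upwards [ho] with s hs
      rw [shear, hc.eq_zero s hs.le, zero_div]
    exact (contDiffAt_const (c := (0 : ℝ))).congr_of_eventuallyEq h

lemma IsShearRate.hasDerivAt (hc : IsShearRate c) (t : ℝ) :
    HasDerivAt (angularVelocity c) (shear c t) t :=
  intervalIntegral.integral_hasDerivAt_right (hc.contDiff_shear.continuous.intervalIntegrable _ _)
    (hc.contDiff_shear.continuous.stronglyMeasurableAtFilter _ _)
    hc.contDiff_shear.continuous.continuousAt

lemma IsShearRate.contDiff_angularVelocity (hc : IsShearRate c) :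
    ContDiff ℝ ∞ (angularVelocity c) := by
  rw [contDiff_infty_iff_deriv]
  refine ⟨fun t => (hc.hasDerivAt t).differentiableAt, ?_⟩
  rw [show deriv (angularVelocity c) = shear c from funext fun t => (hc.hasDerivAt t).deriv]
  exact hc.contDiff_shear

lemma IsShearRate.angularVelocity_eq_zero (hc : IsShearRate c) {t : ℝ} (h0 : 0 ≤ t)
    (ht : t ≤ 1 / 4) : angularVelocity c t = 0 := by
  rw [angularVelocity, intervalIntegral.integral_congr (g := fun _ => 0)]
  · simp
  · intro s hs
    rw [Set.uIcc_of_le h0] at hs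
    have : c s = 0 := hc.eq_zero s (by
      rw [abs_sub_comm]
      exact le_trans (by linarith [hs.2]) (le_abs_self _))
    simp [shear, this]

/-- The weight `t * √(1 - t)` is the second invariant of a vortex with unit shear, so `c` is the
second invariant of the resulting flow. -/
lemma IsShearRate.shear_mul (hc : IsShearRate c) (t : ℝ) :
    |shear c t| * (t * Real.sqrt (1 - t)) = c t := by
  by_cases ht : |t - 1 / 2| < 1 / 2
  · obtain ⟨h1, h2⟩ := abs_lt.1 ht
    have h3 : 0 < Real.sqrt (1 - t) := Real.sqrt_pos.2 (by linarith)
    have h4 : 0 < t := by linarith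
    have h5 : 0 ≤ shear c t := div_nonneg (hc.nonneg t) (by positivity)
    rw [abs_of_nonneg h5, shear, div_mul_cancel₀ _ (by positivity)]
  · have : c t = 0 := hc.eq_zero t (by push Not at ht; linarith)
    simp [shear, this]

/-- For `μr = 1` and `τy = 2` yielding starts at `s = 1`, the maximum of `wideBump`; this flow never
exceeds the yield point. -/
lemma viscIdeal_wideBump_mul (t : ℝ) : viscIdeal 0 1 2 (wideBump t) * wideBump t = wideBump t := by
  have h0 : 0 ≤ wideBump t := wideBump.nonneg
  have h1 : wideBump t ≤ 1 := wideBump.le_one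
  rw [viscIdeal_zero_of_le one_pos two_pos h0 (by linarith), one_mul]

/-- In the plastic range the stress does not depend on the size of the shear rate. -/
lemma viscIdeal_add_narrowBump_mul (t : ℝ) :
    viscIdeal 0 1 2 (wideBump t + narrowBump t) * (wideBump t + narrowBump t) = wideBump t := by
  have h0 : 0 ≤ narrowBump t := narrowBump.nonneg
  -- The support of `narrowBump` is the plateau of `wideBump`, where the shear rate is already at
  -- yield.
  by_cases ht : t ∈ Metric.closedBall (1 / 2 : ℝ) (1 / 8)
  · have h1 : wideBump t = 1 := wideBump.one_of_mem_closedBall ht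
    rw [h1, viscIdeal_zero_of_ge one_pos two_pos (by linarith) (by linarith)]
    norm_num
  · have h1 : narrowBump t = 0 := narrowBump.zero_of_le_dist (by
      rw [Metric.mem_closedBall, not_le] at ht
      exact ht.le)
    rw [h1, add_zero, viscIdeal_wideBump_mul]

/-- The value `1` of `torus` is attained on the core circle, where this inequality separates the two
flows. -/
lemma angularVelocity_lt :
    angularVelocity wideBump 1 < angularVelocity (fun t => wideBump t + narrowBump t) 1 := by
  have h1 := isShearRate_wideBump.contDiff_shear.continuous
  have h2 := isShearRate_wideBump_add_narrowBump.contDiff_shear.continuous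
  have key : ∀ t, shear (fun t => wideBump t + narrowBump t) t
      = shear wideBump t + narrowBump t / (t * Real.sqrt (1 - t)) := fun t => by
    rw [shear, shear, add_div]
  refine intervalIntegral.integral_lt_integral_of_continuousOn_of_le_of_exists_lt zero_lt_one
    h1.continuousOn h2.continuousOn (fun t ht => ?_) ⟨1 / 2, by norm_num, ?_⟩
  · rw [key]
    have : 0 ≤ narrowBump t / (t * Real.sqrt (1 - t)) :=
      div_nonneg narrowBump.nonneg (mul_nonneg ht.1.le (Real.sqrt_nonneg _))
    linarith
  · rw [key, narrowBump.one_of_mem_closedBall (Metric.mem_closedBall_self narrowBump.rIn_pos.le)]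
    have : 0 < Real.sqrt (1 - 1 / 2) := Real.sqrt_pos.2 (by norm_num)
    have : 0 < 1 / (1 / 2 * Real.sqrt (1 - 1 / 2)) := by positivity
    linarith

end Profiles

/-! ### Toroidal vortices -/

section Vortex

variable {d : ℕ} (i₀ i₁ : Fin d)

/-- The infinitesimal rotation in the plane of the coordinates `i₀` and `i₁`. -/
def rot (x : Vec d) : Vec d := EuclideanSpace.single i₁ (x i₀) - EuclideanSpace.single i₀ (x i₁)

/-- The squared distance from the axis of the rotation. -/
def axisDistSq (x : Vec d) : ℝ := x i₀ ^ 2 + x i₁ ^ 2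

/-- Half of the gradient of `axisDistSq`. -/
def axisProj (x : Vec d) (j : Fin d) : ℝ :=
  (if j = i₀ then x i₀ else 0) + if j = i₁ then x i₁ else 0

/-- A function whose level sets are nested tori around the unit circle of the rotation; it is
`cosh⁻²` of the hyperbolic distance from that circle in the meridian half-plane. -/
def torus (x : Vec d) : ℝ := 4 * axisDistSq i₀ i₁ x * ((‖x‖ ^ 2 + 1) ^ 2)⁻¹

/-- The gradient of `torus`. -/
def torusGrad (x : Vec d) (j : Fin d) : ℝ :=
  8 * axisProj i₀ i₁ x j / (‖x‖ ^ 2 + 1) ^ 2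
    - 16 * axisDistSq i₀ i₁ x * x j / (‖x‖ ^ 2 + 1) ^ 3

/-- The strain rate of a vortex with unit shear. -/
def vortexStrain (x : Vec d) : Tensor d :=
  symPart (Matrix.of fun i j => torusGrad i₀ i₁ x j * rot i₀ i₁ x i)

/-- The rotating flow whose angular velocity is `H` as a function of `torus`. -/
def vortex (H : ℝ → ℝ) (x : Vec d) : Vec d := H (torus i₀ i₁ x) • rot i₀ i₁ x

lemma rot_apply (x : Vec d) (i : Fin d) :
    rot i₀ i₁ x i = (if i = i₁ then x i₀ else 0) - if i = i₀ then x i₁ else 0 := by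
  simp [rot, PiLp.single_apply]

lemma sum_rot_mul (x : Vec d) (c : Fin d → ℝ) :
    ∑ i, rot i₀ i₁ x i * c i = x i₀ * c i₁ - x i₁ * c i₀ := by
  simp [rot_apply, sub_mul, Finset.sum_sub_distrib, ite_mul]

lemma sum_axisProj_mul (x : Vec d) (c : Fin d → ℝ) :
    ∑ i, axisProj i₀ i₁ x i * c i = x i₀ * c i₀ + x i₁ * c i₁ := by
  simp [axisProj, add_mul, Finset.sum_add_distrib, ite_mul]

lemma axisDistSq_nonneg (x : Vec d) : 0 ≤ axisDistSq i₀ i₁ x := by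
  unfold axisDistSq; positivity

variable {i₀ i₁}

lemma axisDistSq_le (h : i₀ ≠ i₁) (x : Vec d) : axisDistSq i₀ i₁ x ≤ ‖x‖ ^ 2 := by
  rw [EuclideanSpace.norm_sq_eq, axisDistSq]
  simp only [Real.norm_eq_abs, sq_abs]
  rw [← Finset.sum_pair (f := fun i => x i ^ 2) h]
  exact Finset.sum_le_sum_of_subset_of_nonneg (Finset.subset_univ _) fun _ _ _ => sq_nonneg _

lemma torus_nonneg (x : Vec d) : 0 ≤ torus i₀ i₁ x := by
  have := axisDistSq_nonneg i₀ i₁ x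
  unfold torus; positivity

lemma torus_le_one (h : i₀ ≠ i₁) (x : Vec d) : torus i₀ i₁ x ≤ 1 := by
  rw [torus, mul_inv_le_iff₀ (by positivity)]
  nlinarith [axisDistSq_le h x, sq_nonneg (‖x‖ ^ 2 - 1)]

/-- Gives the vortices compact support: their angular velocity vanishes where `torus ≤ 1 / 4`. -/
lemma norm_le_of_torus (h : i₀ ≠ i₁) {x : Vec d} (hx : 1 / 4 ≤ torus i₀ i₁ x) : ‖x‖ ≤ 4 := by
  rw [torus, le_mul_inv_iff₀ (by positivity)] at hx
  have h1 := axisDistSq_le h x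
  have h2 : (‖x‖ ^ 2 + 1) ^ 2 ≤ 16 * ‖x‖ ^ 2 := by linarith
  have h3 : ‖x‖ ^ 2 ≤ 16 := by nlinarith [sq_nonneg ‖x‖]
  nlinarith [norm_nonneg x]

lemma contDiff_coord (i : Fin d) : ContDiff ℝ ∞ fun x : Vec d => x i :=
  contDiff_euclidean.1 contDiff_id i

lemma partialDeriv_coord_id (i j : Fin d) (x : Vec d) :
    partialDeriv j (fun x : Vec d => x i) x = if i = j then 1 else 0 := by
  rw [partialDeriv_coord (w := fun y => y) differentiableAt_id]
  simp [partialDeriv, PiLp.single_apply]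

lemma partialDeriv_comp {a : Vec d → ℝ} {H : ℝ → ℝ} {H' : ℝ} {x : Vec d}
    (hH : HasDerivAt H H' (a x)) (ha : DifferentiableAt ℝ a x) (j : Fin d) :
    partialDeriv j (fun y => H (a y)) x = H' * partialDeriv j a x := by
  have : HasFDerivAt (fun y => H (a y)) (H' • fderiv ℝ a x) x :=
    hH.comp_hasFDerivAt x ha.hasFDerivAt
  unfold partialDeriv
  rw [this.fderiv]; simp

lemma partialDeriv_const_mul {a : Vec d → ℝ} {x : Vec d} (ha : DifferentiableAt ℝ a x) (c : ℝ)
    (j : Fin d) : partialDeriv j (fun y => c * a y) x = c * partialDeriv j a x :=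
  partialDeriv_const_smul ha c j

lemma contDiff_rot : ContDiff ℝ ∞ (rot i₀ i₁) := by
  refine contDiff_euclidean.2 fun i => ?_
  simp only [rot_apply]
  refine ContDiff.sub ?_ ?_ <;> split_ifs <;>
    first | exact contDiff_const | exact contDiff_coord _

lemma contDiff_axisDistSq : ContDiff ℝ ∞ (axisDistSq i₀ i₁) :=
  ((contDiff_coord _).pow 2).add ((contDiff_coord _).pow 2)

lemma contDiff_torus : ContDiff ℝ ∞ (torus i₀ i₁) :=
  (contDiff_const.mul contDiff_axisDistSq).mul
    ((((contDiff_norm_sq ℝ).add contDiff_const).pow 2).inv fun x => by positivity)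

lemma partialDeriv_axisDistSq (j : Fin d) (x : Vec d) :
    partialDeriv j (axisDistSq i₀ i₁) x = 2 * axisProj i₀ i₁ x j := by
  have hd := fun i : Fin d => (contDiff_coord i).differentiable (by simp) x
  have : axisDistSq i₀ i₁ = fun y => y i₀ * y i₀ + y i₁ * y i₁ := by
    ext y; simp only [axisDistSq]; ring
  have hm := fun i : Fin d => ((contDiff_coord i).mul (contDiff_coord i)).differentiable
    (by simp) x
  rw [this, partialDeriv_add (hm _) (hm _),
    partialDeriv_mul (hd _) (hd _), partialDeriv_mul (hd _) (hd _), partialDeriv_coord_id,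
    partialDeriv_coord_id, axisProj]
  simp only [eq_comm (a := j), mul_ite, mul_one, mul_zero]
  split_ifs <;> ring

lemma partialDeriv_norm_sq (j : Fin d) (x : Vec d) :
    partialDeriv j (fun y : Vec d => ‖y‖ ^ 2) x = 2 * x j := by
  unfold partialDeriv
  rw [fderiv_norm_sq_apply]
  simp [EuclideanSpace.inner_single_right]

lemma partialDeriv_torus (j : Fin d) (x : Vec d) :
    partialDeriv j (torus i₀ i₁) x = torusGrad i₀ i₁ x j := by
  have hn : DifferentiableAt ℝ (fun y : Vec d => ‖y‖ ^ 2) x :=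
    (contDiff_norm_sq ℝ).differentiable (n := ∞) (by simp) x
  have hx : ‖x‖ ^ 2 + 1 ≠ 0 := by positivity
  have hr : HasDerivAt (fun q : ℝ => ((q + 1) ^ 2)⁻¹) (-2 / (‖x‖ ^ 2 + 1) ^ 3) (‖x‖ ^ 2) := by
    have h1 : HasDerivAt (fun q : ℝ => ((q + 1) ^ 2)⁻¹) _ _ :=
      (((hasDerivAt_id (‖x‖ ^ 2)).add_const 1).pow 2).inv (pow_ne_zero 2 hx)
    refine h1.congr_deriv ?_
    simp only [id, Pi.pow_apply]
    norm_num
    field_simp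
  have ha := contDiff_axisDistSq (i₀ := i₀) (i₁ := i₁) |>.differentiable (by simp) x
  have hrd : DifferentiableAt ℝ (fun y : Vec d => ((‖y‖ ^ 2 + 1) ^ 2)⁻¹) x :=
    DifferentiableAt.comp (g := fun q : ℝ => ((q + 1) ^ 2)⁻¹) x hr.differentiableAt hn
  unfold torus
  rw [partialDeriv_mul (ha.const_mul 4) hrd, partialDeriv_const_mul ha, partialDeriv_axisDistSq,
    partialDeriv_comp hr hn, partialDeriv_norm_sq, torusGrad]
  field_simp; ring

lemma partialDeriv_rot (i j : Fin d) (x : Vec d) :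
    partialDeriv j (fun y => rot i₀ i₁ y i) x
      = (if i = i₁ ∧ j = i₀ then 1 else 0) - if i = i₀ ∧ j = i₁ then 1 else 0 := by
  have h0 : ∀ k : Fin d, ∀ (p : Prop) [Decidable p],
      partialDeriv j (fun y : Vec d => if p then y k else 0) x = if p ∧ j = k then 1 else 0 := by
    intro k p _
    by_cases hp : p
    · simp [hp, partialDeriv_coord_id, eq_comm]
    · simp [hp, partialDeriv]
  have hd : ∀ k : Fin d, ∀ (p : Prop) [Decidable p],
      DifferentiableAt ℝ (fun y : Vec d => if p then y k else 0) x := by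
    intro k p _
    by_cases hp : p
    · simpa [hp] using (contDiff_coord k).differentiable (by simp) x
    · simp [hp]
  simp only [rot_apply]
  rw [← h0 i₀, ← h0 i₁]
  unfold partialDeriv
  rw [fderiv_fun_sub (hd _ _) (hd _ _)]; rfl

lemma classicalGradient_vortex {H h : ℝ → ℝ} (hH : ∀ t, HasDerivAt H (h t) t) (x : Vec d)
    (i j : Fin d) : classicalGradient (vortex i₀ i₁ H) x i j
      = h (torus i₀ i₁ x) * (torusGrad i₀ i₁ x j * rot i₀ i₁ x i)
        + H (torus i₀ i₁ x) * ((if i = i₁ ∧ j = i₀ then 1 else 0)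
          - if i = i₀ ∧ j = i₁ then 1 else 0) := by
  have ht := contDiff_torus (i₀ := i₀) (i₁ := i₁) |>.differentiable (by simp) x
  have hHd : DifferentiableAt ℝ (fun y => H (torus i₀ i₁ y)) x :=
    ((hH _).comp_hasFDerivAt x ht.hasFDerivAt).differentiableAt
  have hr := contDiff_rot (i₀ := i₀) (i₁ := i₁) |>.differentiable (by simp) x
  have hri : DifferentiableAt ℝ (fun y => rot i₀ i₁ y i) x :=
    (contDiff_euclidean.1 contDiff_rot i).differentiable (n := ∞) (by simp) x
  have : classicalGradient (vortex i₀ i₁ H) x i j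
      = partialDeriv j (fun y => H (torus i₀ i₁ y) * rot i₀ i₁ y i) x :=
    (partialDeriv_coord (hHd.smul hr) i j).symm
  rw [this, partialDeriv_mul hHd hri, partialDeriv_comp (hH _) ht, partialDeriv_torus,
    partialDeriv_rot]
  ring

/-- The gradient of the rigid rotation is antisymmetric, so only the variation of the angular
velocity strains the fluid. -/
lemma symPart_classicalGradient_vortex {H h : ℝ → ℝ} (hH : ∀ t, HasDerivAt H (h t) t)
    (x : Vec d) : symPart (classicalGradient (vortex i₀ i₁ H) x)
      = h (torus i₀ i₁ x) • vortexStrain i₀ i₁ x := by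
  ext i j
  rw [symPart_apply, classicalGradient_vortex hH, classicalGradient_vortex hH, Matrix.smul_apply,
    vortexStrain, symPart_apply, Matrix.of_apply, Matrix.of_apply, smul_eq_mul]
  simp only [and_comm (a := j = _)]
  ring

/-- `torus` is invariant under the rotation. This makes every vortex divergence-free and removes the
cross term from the norm of the strain. -/
lemma sum_rot_mul_torusGrad (x : Vec d) : ∑ i, rot i₀ i₁ x i * torusGrad i₀ i₁ x i = 0 := by
  by_cases h : i₀ = i₁
  · rw [sum_rot_mul, h]; ring
  · rw [sum_rot_mul]
    simp only [torusGrad, axisProj, h, Ne.symm h, if_true, if_false]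
    ring

lemma trace_classicalGradient_vortex (h01 : i₀ ≠ i₁) {H h : ℝ → ℝ}
    (hH : ∀ t, HasDerivAt H (h t) t) (x : Vec d) :
    (classicalGradient (vortex i₀ i₁ H) x).trace = 0 := by
  have e : ∀ i, classicalGradient (vortex i₀ i₁ H) x i i
      = h (torus i₀ i₁ x) * (rot i₀ i₁ x i * torusGrad i₀ i₁ x i) := by
    intro i
    have h1 : ¬(i = i₁ ∧ i = i₀) := fun hi => h01 (hi.2.symm.trans hi.1)
    have h2 : ¬(i = i₀ ∧ i = i₁) := fun hi => h01 (hi.1.symm.trans hi.2)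
    rw [classicalGradient_vortex hH, if_neg h1, if_neg h2]; ring
  simp only [Matrix.trace, Matrix.diag_apply, e]
  rw [← Finset.mul_sum, sum_rot_mul_torusGrad, mul_zero]

lemma contract_symPart_outer (a b : Fin d → ℝ) :
    contract (symPart (Matrix.of fun i j => a j * b i)) (symPart (Matrix.of fun i j => a j * b i))
      = 1 / 2 * ((∑ i, a i * a i) * (∑ i, b i * b i) + (∑ i, b i * a i) ^ 2) := by
  rw [contract_symPart_right]
  have e : ∀ i j, 1 / 2 * (a j * b i + a i * b j) * (a j * b i)
      = 1 / 2 * ((b i * b i) * (a j * a j)) + 1 / 2 * ((b i * a i) * (b j * a j)) :=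
    fun i j => by ring
  simp only [contract, symPart_apply, Matrix.of_apply, e, Finset.sum_add_distrib,
    ← Finset.mul_sum, ← Finset.sum_mul]
  ring

/-- The reason for the choice of `torus`. As its gradient is orthogonal to the rotation, the squared
invariant is `|∇torus|² |rot|² / 4`, and with `ρ` the squared distance from the axis and `q = ‖x‖ ^
2 + 1` this equals `16 ρ² / q⁴ * (1 - 4 ρ / q²)`, a function of `torus = 4 ρ / q²` alone. -/
lemma tensorInv_vortexStrain (h : i₀ ≠ i₁) (x : Vec d) : tensorInv (vortexStrain i₀ i₁ x)
    = torus i₀ i₁ x * Real.sqrt (1 - torus i₀ i₁ x) := by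
  have h1 : 0 ≤ 1 - torus i₀ i₁ x := sub_nonneg.2 (torus_le_one h x)
  have hq : ‖x‖ ^ 2 + 1 ≠ 0 := by positivity
  have hr : ∑ i, rot i₀ i₁ x i * rot i₀ i₁ x i = axisDistSq i₀ i₁ x := by
    rw [sum_rot_mul]
    simp only [rot_apply, h, h.symm, if_true, if_false, axisDistSq]
    ring
  have hpp : ∑ i, axisProj i₀ i₁ x i * axisProj i₀ i₁ x i = axisDistSq i₀ i₁ x := by
    rw [sum_axisProj_mul]
    simp only [axisProj, h, h.symm, if_true, if_false, axisDistSq]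
    ring
  have hpx : ∑ i, axisProj i₀ i₁ x i * x i = axisDistSq i₀ i₁ x := by
    rw [sum_axisProj_mul, axisDistSq]; ring
  have hxx : ∑ i, x i * x i = ‖x‖ ^ 2 := by
    rw [EuclideanSpace.norm_sq_eq]
    exact Finset.sum_congr rfl fun i _ => by rw [Real.norm_eq_abs, sq_abs, sq]
  have hg : ∑ i, torusGrad i₀ i₁ x i * torusGrad i₀ i₁ x i
      = 64 * axisDistSq i₀ i₁ x / (‖x‖ ^ 2 + 1) ^ 4
        - 256 * axisDistSq i₀ i₁ x ^ 2 / (‖x‖ ^ 2 + 1) ^ 6 := by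
    have e : ∀ i, torusGrad i₀ i₁ x i * torusGrad i₀ i₁ x i
        = 64 / (‖x‖ ^ 2 + 1) ^ 4 * (axisProj i₀ i₁ x i * axisProj i₀ i₁ x i)
          - 256 * axisDistSq i₀ i₁ x / (‖x‖ ^ 2 + 1) ^ 5 * (axisProj i₀ i₁ x i * x i)
          + 256 * axisDistSq i₀ i₁ x ^ 2 / (‖x‖ ^ 2 + 1) ^ 6 * (x i * x i) := by
      intro i
      unfold torusGrad
      field_simp; ring
    simp only [e, Finset.sum_add_distrib, Finset.sum_sub_distrib, ← Finset.mul_sum, hpp, hpx, hxx]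
    field_simp; ring
  have hs : (torus i₀ i₁ x * Real.sqrt (1 - torus i₀ i₁ x)) ^ 2
      = 1 / 2 * contract (vortexStrain i₀ i₁ x) (vortexStrain i₀ i₁ x) := by
    rw [vortexStrain, contract_symPart_outer, hg, hr, sum_rot_mul_torusGrad, mul_pow,
      Real.sq_sqrt h1, torus]
    field_simp; ring
  rw [tensorInv, ← hs, Real.sqrt_sq (mul_nonneg (torus_nonneg x) (Real.sqrt_nonneg _))]

lemma isTest_vortex (h : i₀ ≠ i₁) {c : ℝ → ℝ} (hc : IsShearRate c) :
    IsTest (Metric.ball (0 : Vec d) 5) (vortex i₀ i₁ (angularVelocity c)) := by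
  have hsupp : Function.support (vortex i₀ i₁ (angularVelocity c))
      ⊆ Metric.closedBall (0 : Vec d) 4 := by
    intro x hx
    rw [mem_closedBall_zero_iff]
    refine norm_le_of_torus h (le_of_not_gt fun ht => hx ?_)
    rw [vortex, hc.angularVelocity_eq_zero (torus_nonneg x) ht.le, zero_smul]
  exact ⟨(hc.contDiff_angularVelocity.comp contDiff_torus).smul contDiff_rot,
    HasCompactSupport.of_support_subset_isCompact (isCompact_closedBall _ _) hsupp,
    (closure_minimal hsupp Metric.isClosed_closedBall).trans
      (Metric.closedBall_subset_ball (by norm_num))⟩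

/-- The velocity field with shear rate `c`. -/
def vortexField (h : i₀ ≠ i₁) {c : ℝ → ℝ} (hc : IsShearRate c) :
    L2 (Metric.ball (0 : Vec d) 5) := ((isTest_vortex h hc).memLp _ 2).toLp

/-- The stress of the vortices. -/
def vortexStress (i₀ i₁ : Fin d) (x : Vec d) : Tensor d :=
  (2 : ℝ) • symPart (classicalGradient (vortex i₀ i₁ (angularVelocity wideBump)) x)

lemma isTest_vortexStress (h : i₀ ≠ i₁) (i j : Fin d) :
    IsTest (Metric.ball (0 : Vec d) 5) fun x => vortexStress i₀ i₁ x i j := by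
  have ht := isTest_vortex h isShearRate_wideBump
  have e : (fun x => vortexStress i₀ i₁ x i j) = fun x =>
      partialDeriv j (vortex i₀ i₁ (angularVelocity wideBump)) x i
        + partialDeriv i (vortex i₀ i₁ (angularVelocity wideBump)) x j := by
    ext x
    rw [vortexStress, Matrix.smul_apply, symPart_apply, smul_eq_mul, classicalGradient,
      Matrix.of_apply, Matrix.of_apply]
    ring
  rw [e]
  exact ((ht.pderiv j).coord i).add ((ht.pderiv i).coord j)

lemma symPart_vortexStress (x : Vec d) : symPart (vortexStress i₀ i₁ x) = vortexStress i₀ i₁ x := by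
  ext i j
  simp only [vortexStress, symPart_apply, Matrix.smul_apply, smul_eq_mul]
  ring

/-- Viscosity times shear rate is `wideBump` by `hv`, so the stress is `vortexStress` whatever `c`
is. -/
lemma isStokesSolution_vortexField (h : i₀ ≠ i₁) {c : ℝ → ℝ} (hc : IsShearRate c)
    (hv : ∀ t, viscIdeal 0 1 2 (c t) * c t = wideBump t) :
    IsStokesSolution (Metric.ball (0 : Vec d) 5) (fun _ s => viscIdeal 0 1 2 s)
      (stressForce (vortexStress i₀ i₁)) (vortexField h hc) 0 := by
  have ht := isTest_vortex h hc
  refine isStokesSolution_of_stress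
    (ht.mem_admissible Metric.isOpen_ball (trace_classicalGradient_vortex h hc.hasDerivAt))
    (isTest_vortexStress h) symPart_vortexStress ?_
  filter_upwards [ht.weakGradient_ae_eq Metric.isOpen_ball] with x hx
  have e : strainRate (Metric.ball 0 5) (vortexField h hc) x
      = shear c (torus i₀ i₁ x) • vortexStrain i₀ i₁ x := by
    rw [strainRate_eq_symPart, ← symPart_classicalGradient_vortex hc.hasDerivAt, ← hx]; rfl
  unfold vortexField at e
  rw [secondInv_eq_tensorInv, e, tensorInv_smul, tensorInv_vortexStrain h, hc.shear_mul,
    vortexStress, symPart_classicalGradient_vortex isShearRate_wideBump.hasDerivAt, smul_smul,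
    smul_smul]
  congr 1
  -- Both sides carry the common divisor `t * √(1 - t)`; what remains is `hv`.
  rw [shear, shear, ← hv]
  ring

/-- Continuous representatives that agree almost everywhere on the ball agree everywhere on it, so
one point of the core circle decides. -/
lemma vortexField_ne (h : i₀ ≠ i₁) : vortexField h isShearRate_wideBump
    ≠ vortexField h isShearRate_wideBump_add_narrowBump := by
  intro heq
  have t1 := isTest_vortex h isShearRate_wideBump
  have t2 := isTest_vortex h isShearRate_wideBump_add_narrowBump
  have hae : vortex i₀ i₁ (angularVelocity wideBump)
      =ᵐ[volume.restrict (Metric.ball (0 : Vec d) 5)]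
      vortex i₀ i₁ (angularVelocity fun t => wideBump t + narrowBump t) := by
    refine (t1.memLp _ 2).coeFn_toLp.symm.trans (EventuallyEq.trans ?_ (t2.memLp _ 2).coeFn_toLp)
    rw [show (t1.memLp (Metric.ball 0 5) 2).toLp = (t2.memLp (Metric.ball 0 5) 2).toLp from heq]
  have hon := Measure.eqOn_open_of_ae_eq hae Metric.isOpen_ball t1.1.continuous.continuousOn
    t2.1.continuous.continuousOn
  set e : Vec d := EuclideanSpace.single i₀ 1 with he
  have hn : ‖e‖ = 1 := by simp [he]
  have h0 : e i₀ = 1 := by simp [he]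
  have h1 : e i₁ = 0 := by simp [he, h]
  have htor : torus i₀ i₁ e = 1 := by
    rw [torus, axisDistSq, hn, h0, h1]; norm_num
  have hrot : rot i₀ i₁ e i₁ = 1 := by
    rw [rot_apply, h0]; simp [h.symm]
  have hev := congrArg (fun v : Vec d => v i₁) (hon (x := e) (by
    rw [mem_ball_zero_iff, hn]; norm_num))
  simp only [vortex, htor, PiLp.smul_apply, hrot, smul_eq_mul, mul_one] at hev
  exact angularVelocity_lt.ne hev

end Vortex

/-- Without lower viscosity bound, velocity solutions for the ideal law need not be unique. -/
theorem exists_two_solutions_ideal {d : ℕ} (hd : 1 < d) :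
    ∃ (Ω : Set (Vec d)) (μr τy : ℝ) (f : Vec d → Vec d),
      IsOpen Ω ∧ IsConnected Ω ∧ Bornology.IsBounded Ω ∧ 0 < μr ∧ 0 < τy ∧
      MemLp f 2 (volume.restrict Ω) ∧
      ∃ (u₁ u₂ : L2 Ω) (p₁ p₂ : Vec d → ℝ),
        IsStokesSolution Ω (fun _ s => viscIdeal 0 μr τy s) f u₁ p₁ ∧
        IsStokesSolution Ω (fun _ s => viscIdeal 0 μr τy s) f u₂ p₂ ∧
        IsVelocitySolution Ω (fun _ s => viscIdeal 0 μr τy s) f u₁ ∧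
        IsVelocitySolution Ω (fun _ s => viscIdeal 0 μr τy s) f u₂ ∧
        u₁ ≠ u₂ := by
  have h : (⟨0, by omega⟩ : Fin d) ≠ ⟨1, hd⟩ := by simp
  have s1 := isStokesSolution_vortexField h isShearRate_wideBump viscIdeal_wideBump_mul
  have s2 := isStokesSolution_vortexField h isShearRate_wideBump_add_narrowBump
    viscIdeal_add_narrowBump_mul
  exact ⟨Metric.ball 0 5, 1, 2, stressForce (vortexStress _ _), Metric.isOpen_ball,
    (convex_ball _ _).isConnected (Metric.nonempty_ball.2 (by norm_num)), Metric.isBounded_ball,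
    one_pos, two_pos, memLp_stressForce (isTest_vortexStress h), _, _, 0, 0, s1, s2,
    s1.isVelocitySolution, s2.isVelocitySolution, vortexField_ne h⟩

end Viscoplastic

end

/-! ### The main theorem -/

theorem mainTheorem2 (d : ℕ) (hd : d = 2 ∨ d = 3) :
    (∀ (Ω : Set (Viscoplastic.Vec d)), IsOpen Ω → Bornology.IsBounded Ω →
      ∀ (μr τy : Viscoplastic.Vec d → ℝ) (f : Viscoplastic.Vec d → Viscoplastic.Vec d),
        AEMeasurable μr (volume.restrict Ω) →
        MemLp τy 2 (volume.restrict Ω) →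
        MemLp f 2 (volume.restrict Ω) →
        (∀ᵐ x ∂(volume.restrict Ω), 0 < μr x ∧ 0 < τy x) →
        -- the ideal law, with lower viscosity bound `μlow`
        (∀ μlow : ℝ, 0 ≤ μlow →
          (IntegrableOn (fun x => Viscoplastic.phiIdeal (μr x) (τy x) 0) Ω →
            (∀ u ∈ Viscoplastic.Admissible Ω, Viscoplastic.EnergyFinite Ω
              (fun x s => Viscoplastic.phiIdeal (μr x) (τy x) s) f u) ∧
            ConvexOn ℝ (Viscoplastic.Admissible Ω) (Viscoplastic.energy Ω
              (fun x s => Viscoplastic.phiIdeal (μr x) (τy x) s) μlow f) ∧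
            (0 < μlow → StrictConvexOn ℝ (Viscoplastic.Admissible Ω) (Viscoplastic.energy Ω
              (fun x s => Viscoplastic.phiIdeal (μr x) (τy x) s) μlow f))) ∧
          (0 < μlow →
            (∃! u : Viscoplastic.L2 Ω, Viscoplastic.IsVelocitySolution Ω
              (fun x s => Viscoplastic.viscIdeal μlow (μr x) (τy x) s) f u) ∧
            (∀ (u₁ u₂ : Viscoplastic.L2 Ω) (p₁ p₂ : Viscoplastic.Vec d → ℝ),
              Viscoplastic.IsStokesSolution Ω
                (fun x s => Viscoplastic.viscIdeal μlow (μr x) (τy x) s) f u₁ p₁ →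
              Viscoplastic.IsStokesSolution Ω
                (fun x s => Viscoplastic.viscIdeal μlow (μr x) (τy x) s) f u₂ p₂ →
              u₁ = u₂))) ∧
        -- the composite law
        (IntegrableOn (fun x => Viscoplastic.phiComposite (μr x) (τy x) 0) Ω →
          (∀ u ∈ Viscoplastic.Admissible Ω, Viscoplastic.EnergyFinite Ω
            (fun x s => Viscoplastic.phiComposite (μr x) (τy x) s) f u) ∧
          ConvexOn ℝ (Viscoplastic.Admissible Ω) (Viscoplastic.energy Ω
            (fun x s => Viscoplastic.phiComposite (μr x) (τy x) s) 0 f) ∧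
          StrictConvexOn ℝ (Viscoplastic.Admissible Ω) (Viscoplastic.energy Ω
            (fun x s => Viscoplastic.phiComposite (μr x) (τy x) s) 0 f)) ∧
        (∀ u₁ u₂ : Viscoplastic.L2 Ω,
          Viscoplastic.IsVelocitySolution Ω
            (fun x s => Viscoplastic.viscComposite (μr x) (τy x) s) f u₁ →
          Viscoplastic.IsVelocitySolution Ω
            (fun x s => Viscoplastic.viscComposite (μr x) (τy x) s) f u₂ →
          u₁ = u₂) ∧
        (∀ (u₁ u₂ : Viscoplastic.L2 Ω) (p₁ p₂ : Viscoplastic.Vec d → ℝ),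
          Viscoplastic.IsStokesSolution Ω
            (fun x s => Viscoplastic.viscComposite (μr x) (τy x) s) f u₁ p₁ →
          Viscoplastic.IsStokesSolution Ω
            (fun x s => Viscoplastic.viscComposite (μr x) (τy x) s) f u₂ p₂ →
          u₁ = u₂)) ∧
    -- failure of uniqueness for the ideal law without lower viscosity bound
    (∃ (Ω : Set (Viscoplastic.Vec d)) (μr τy : ℝ)
        (f : Viscoplastic.Vec d → Viscoplastic.Vec d),
      IsOpen Ω ∧ IsConnected Ω ∧ Bornology.IsBounded Ω ∧ 0 < μr ∧ 0 < τy ∧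
      MemLp f 2 (volume.restrict Ω) ∧
      ∃ (u₁ u₂ : Viscoplastic.L2 Ω) (p₁ p₂ : Viscoplastic.Vec d → ℝ),
        Viscoplastic.IsStokesSolution Ω (fun _ s => Viscoplastic.viscIdeal 0 μr τy s) f u₁ p₁ ∧
        Viscoplastic.IsStokesSolution Ω (fun _ s => Viscoplastic.viscIdeal 0 μr τy s) f u₂ p₂ ∧
        Viscoplastic.IsVelocitySolution Ω (fun _ s => Viscoplastic.viscIdeal 0 μr τy s) f u₁ ∧
        Viscoplastic.IsVelocitySolution Ω (fun _ s => Viscoplastic.viscIdeal 0 μr τy s) f u₂ ∧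
        u₁ ≠ u₂) := by
  have hd0 : 0 < d := by omega
  refine ⟨fun Ω hΩ hb μr τy f hμr hτy hf hpos => ⟨fun μlow hμlow => ⟨fun h0 => ?_, fun hμ => ?_⟩,
    fun h0 => ?_, fun u₁ u₂ => ?_, fun u₁ u₂ p₁ p₂ h₁ h₂ => ?_⟩,
    Viscoplastic.exists_two_solutions_ideal (by omega)⟩
  · have hfin : ∀ u ∈ Viscoplastic.Admissible Ω, Viscoplastic.EnergyFinite Ω
        (fun x s => Viscoplastic.phiIdeal (μr x) (τy x) s) f u := fun u hu =>
      Viscoplastic.energyFinite_of_bounds Viscoplastic.measurable_phiIdeal hμr hτy hf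
        (Viscoplastic.phiIdeal_bounds hpos) h0 hu.1
    exact ⟨hfin,
      Viscoplastic.convexOn_energy (m := fun x s => Viscoplastic.viscIdeal μlow (μr x) (τy x) s)
        hΩ hf hfin (Viscoplastic.ideal_energyDensity_le hμlow hpos),
      fun hμ => Viscoplastic.strictConvexOn_energy
        (m := fun x s => Viscoplastic.viscIdeal μlow (μr x) (τy x) s)
        hΩ hb hd0 hf hfin (Viscoplastic.ideal_energyDensity_lt hμ hpos)⟩
  · obtain ⟨u, hu⟩ :=
      Viscoplastic.exists_isVelocitySolution_ideal hΩ hb hd0 hμ hμr hτy hf hpos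
    have huniq := Viscoplastic.ideal_energyDensity_lt hμ hpos
    exact ⟨⟨u, hu, fun v hv => hv.unique hΩ hb hd0 huniq hu⟩, fun u₁ u₂ p₁ p₂ h₁ h₂ =>
      h₁.isVelocitySolution.unique hΩ hb hd0 huniq h₂.isVelocitySolution⟩
  · have hfin : ∀ u ∈ Viscoplastic.Admissible Ω, Viscoplastic.EnergyFinite Ω
        (fun x s => Viscoplastic.phiComposite (μr x) (τy x) s) f u := fun u hu =>
      Viscoplastic.energyFinite_of_bounds Viscoplastic.measurable_phiComposite hμr hτy hf
        (Viscoplastic.phiComposite_bounds hpos) h0 hu.1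
    have hstrict := Viscoplastic.strictConvexOn_energy
      (m := fun x s => Viscoplastic.viscComposite (μr x) (τy x) s)
      hΩ hb hd0 hf hfin (Viscoplastic.composite_energyDensity_lt hpos)
    exact ⟨hfin, hstrict.convexOn, hstrict⟩
  · exact fun h₁ h₂ => h₁.unique hΩ hb hd0 (Viscoplastic.composite_energyDensity_lt hpos) h₂
  · exact h₁.isVelocitySolution.unique hΩ hb hd0 (Viscoplastic.composite_energyDensity_lt hpos)
      h₂.isVelocitySolution
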